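/- Fix real parameters $\alpha>2$, $\mu>0$, $\beta>0$, $0<\gamma<1$, $N\ge 0$, $M>0$ and an integer $m\ge 1$ with $2\pi/m<\pi/2$. Let $C_1,\dots,C_m$ be the half-open cones of angle $2\pi/m$ with vertex at the origin that partition the plane (up to the vertex), $C_1$ being symmetric about the positive first coordinate axis (up to its boundary). Let $\ell(r)=\min(r^{-\alpha},1)$, and for $0<\epsilon<1$ let $c=M(1-\epsilon)^{-1}$. Network. Let $\Phi$ be the set of nodes, a point process in $\mathbb R^2$. In each time slot $t=0,1,2,\dots$ every node $z\in\Phi$ has a destination cone $z+C_{d(z,t)}$; let $n_t(z)$ be the nearest neighbour of $z$ among the other nodes in this cone, and put $$P_z(t)=\frac{c}{\ell(|z-n_t(z)|)},\qquad p_z(t)=\frac{M}{P_z(t)} .$$ The choices of the cones are arbitrary: they may be random, dependent across nodes and slots, and may depend on $\Phi$ and on the past of the network. In slot $t$, conditionally on $\Phi$, on the cone choices in slots $0,\dots,t$ and on the on/off states and fading powers of the earlier slots, the on/off indicators $\mathbf 1_z(t)$, $z\in\Phi$, are independent with $\mathbb P(\mathbf 1_z(t)=1)=p_z(t)$, and the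 fading powers $h_t(z,y)$, $z,y\in\Phi$, are i.i.d. exponential with parameter $\mu$ and independent of the on/off indicators. For $x,y\in\Phi$ let $$\mathsf{SINR}_{xy}(t)=\frac{P_x(t)\,h_t(x,y)\,\ell(|x-y|)\,\mathbf 1_x(t)\,(1-\mathbf 1_y(t))}{\gamma\sum_{z\in\Phi\setminus\{x,y\}}\mathbf 1_z(t)P_z(t)h_t(z,y)\ell(|z-y|)+N},$$ and let $$T(x)=\min\{t>0:\ \mathsf{SINR}_{x,n_t(x)}(t)>\beta\}\in\{1,2,\dots\}\cup\{\infty\}$$ be the time for a packet to be successfully received at the nearest neighbour of $x$ in its destination cone. Theorem. Suppose $\beta\gamma<1$. Then there is $\epsilon_0\in(0,1]$, not depending on the intensity $\lambda$, such that for every $\epsilon\in(0,\epsilon_0)$, every $\lambda>0$ and every $x\in\mathbb R^2$: if $\Phi$ has the law $\mathbb P^x$, the Palm distribution at $x$ of the homogeneous Poisson point process of intensity $\lambda$ in $\mathbb R^2$, then $$\mathbb E^x\{T(x)\}<\infty .$$ -/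

import Mathlib

open MeasureTheory ProbabilityTheory
open scoped ENNReal NNReal

noncomputable section

/-! ### Point configurations, Poisson processes and Palm distributions in the plane -/

/-- The Euclidean plane. -/
abbrev Plane : Type := EuclideanSpace ℝ (Fin 2)

/-- A locally finite set of points of the plane. -/
@[ext]
structure PointConfig where
  /-- the set of points -/
  points : Set Plane
  locallyFinite : ∀ A : Set Plane, Bornology.IsBounded A → (points ∩ A).Finite

namespace PointConfig

/-- The number of points in `A` (used for bounded `A`, where it is finite). -/
def count (φ : PointConfig) (A : Set Plane) : ℕ := (φ.points ∩ A).ncard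

/-- The usual sigma-algebra on configurations, generated by the numbers of points in bounded
Borel sets. -/
instance : MeasurableSpace PointConfig :=
  ⨆ (A : Set Plane) (_ : MeasurableSet A) (_ : Bornology.IsBounded A),
    MeasurableSpace.comap (fun φ : PointConfig => φ.count A) ⊤

/-- The configuration translated by the vector `v`. -/
def translate (φ : PointConfig) (v : Plane) : PointConfig where
  points := (fun y => y + v) '' φ.points
  locallyFinite := by
    intro A hA
    have hB : Bornology.IsBounded ((fun y : Plane => y + (-v)) '' A) := by
      have hl : LipschitzWith 1 (fun y : Plane => y + (-v)) :=
        LipschitzWith.of_dist_le_mul (by simp)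
      exact hl.isBounded_image hA
    refine ((φ.locallyFinite _ hB).image (fun y => y + v)).subset ?_
    rintro _ ⟨⟨y, hy, rfl⟩, hyA⟩
    exact ⟨y, ⟨hy, ⟨y + v, hyA, by simp⟩⟩, rfl⟩

end PointConfig

/-- `P` is the law of a homogeneous Poisson point process of intensity `lam` in the plane:
counts in bounded Borel sets are Poisson with mean `lam` times the area, and counts in disjoint
sets are independent. -/
structure IsPoissonLaw (lam : ℝ) (P : Measure PointConfig) : Prop where
  isProbabilityMeasure : IsProbabilityMeasure P
  count_law : ∀ A : Set Plane, MeasurableSet A → Bornology.IsBounded A →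
    HasLaw (fun φ : PointConfig => φ.count A)
      (poissonMeasure (Real.toNNReal (lam * (volume : Measure Plane).real A))) P
  count_indep : ∀ (n : ℕ) (A : Fin n → Set Plane), (∀ i, MeasurableSet (A i)) →
    (∀ i, Bornology.IsBounded (A i)) → Pairwise (fun i j => Disjoint (A i) (A j)) →
    iIndepFun (fun i (φ : PointConfig) => φ.count (A i)) P

/-- `Q` is the Palm distribution at the point `x` of a stationary point process with law `P` and
intensity `lam`: for every bounded Borel set `B` and every event `E`, the mean number of points
`y` of the process in `B` from which, after moving `y` to `x`, the configuration lies in `E` is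
`lam * |B| * Q E`. -/
structure IsPalmLaw (lam : ℝ) (P : Measure PointConfig) (x : Plane) (Q : Measure PointConfig) :
    Prop where
  isProbabilityMeasure : IsProbabilityMeasure Q
  campbell : ∀ B : Set Plane, MeasurableSet B → Bornology.IsBounded B →
    ∀ E : Set PointConfig, MeasurableSet E →
    ∫⁻ φ, (({y | y ∈ φ.points ∩ B ∧ φ.translate (x - y) ∈ E}.ncard : ℕ) : ℝ≥0∞) ∂P
      = ENNReal.ofReal lam * volume B * Q E

/-! ### Cones, path loss and the space-time SINR graph -/

/-- The `k`-th of the `m` half-open cones of angle `2π/m` with vertex at the origin. The cone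
with `k = 0` opens to the right and is symmetric about the first axis (up to its boundary).
The vertex itself is left out: it never matters for nearest neighbours. -/
def cone (m : ℕ) (k : Fin m) : Set Plane :=
  {v | ∃ r θ : ℝ, 0 < r ∧
    (2 * (k : ℝ) - 1) * (Real.pi / m) ≤ θ ∧ θ < (2 * (k : ℝ) + 1) * (Real.pi / m) ∧
    v = !₂[r * Real.cos θ, r * Real.sin θ]}

/-- The path loss `min (r ^ (-α)) 1`, for `r > 0`. -/
def pathLoss (α r : ℝ) : ℝ := min (r ^ (-α)) 1

/-- The parameters of the network. -/
structure SINRParams where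
  /-- path-loss exponent -/
  alpha : ℝ
  /-- parameter of the exponential fading -/
  mu : ℝ
  /-- SINR threshold -/
  beta : ℝ
  /-- interference suppression parameter -/
  gamma : ℝ
  /-- noise variance -/
  noise : ℝ
  /-- average power constraint `M` -/
  avgPower : ℝ
  /-- the constant `ε` of the power control -/
  eps : ℝ

/-- The power constant `c = M (1 - ε)⁻¹`. -/
def SINRParams.c (p : SINRParams) : ℝ := p.avgPower * (1 - p.eps)⁻¹

/-- The random data of a network whose nodes are labelled by the natural numbers. -/
structure Network (Ω : Type*) (m : ℕ) where
  /-- the point process of nodes -/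
  config : Ω → PointConfig
  /-- the position of the node with label `i` -/
  pos : ℕ → Ω → Plane
  /-- `dest t i` is the index of the destination cone of node `i` in slot `t` -/
  dest : ℕ → ℕ → Ω → Fin m
  /-- `isOn t i` tells whether node `i` transmits in slot `t` -/
  isOn : ℕ → ℕ → Ω → Bool
  /-- `fade t i j` is the fading power from node `i` to node `j` in slot `t` -/
  fade : ℕ → ℕ → ℕ → Ω → ℝ

namespace Network

variable {Ω : Type*} {m : ℕ}

/-- In slot `t`, node `j` is nearest to node `i` among the nodes other than `i` in the
destination cone of `i`. -/
def IsNearest (S : Network Ω m) (t i j : ℕ) (ω : Ω) : Prop :=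
  j ≠ i ∧ S.pos j ω - S.pos i ω ∈ cone m (S.dest t i ω) ∧
    ∀ k, k ≠ i → S.pos k ω - S.pos i ω ∈ cone m (S.dest t i ω) →
      dist (S.pos i ω) (S.pos j ω) ≤ dist (S.pos i ω) (S.pos k ω)

/-- The label of the nearest neighbour of node `i` in its destination cone in slot `t`
(almost surely there is exactly one). -/
def nn (S : Network Ω m) (t i : ℕ) (ω : Ω) : ℕ := sInf {j | S.IsNearest t i j ω}

/-- The path loss between nodes `i` and `j`. -/
def loss (S : Network Ω m) (p : SINRParams) (i j : ℕ) (ω : Ω) : ℝ :=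
  pathLoss p.alpha (dist (S.pos i ω) (S.pos j ω))

/-- The transmission power of node `i` in slot `t`. -/
def power (S : Network Ω m) (p : SINRParams) (t i : ℕ) (ω : Ω) : ℝ :=
  p.c * (S.loss p i (S.nn t i ω) ω)⁻¹

/-- The transmission probability of node `i` in slot `t`. -/
def txProb (S : Network Ω m) (p : SINRParams) (t i : ℕ) (ω : Ω) : ℝ :=
  p.avgPower * (S.power p t i ω)⁻¹

/-- The interference at node `j` in slot `t` for a transmission from node `i`. -/
def interference (S : Network Ω m) (p : SINRParams) (t i j : ℕ) (ω : Ω) : ℝ≥0∞ :=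
  ∑' z : ℕ, if z ≠ i ∧ z ≠ j ∧ S.isOn t z ω = true then
    ENNReal.ofReal (S.power p t z ω * S.fade t z j ω * S.loss p z j ω) else 0

/-- The signal-to-interference-plus-noise ratio from node `i` to node `j` in slot `t`. -/
def sinr (S : Network Ω m) (p : SINRParams) (t i j : ℕ) (ω : Ω) : ℝ≥0∞ :=
  if S.isOn t i ω = true ∧ S.isOn t j ω = false then
    ENNReal.ofReal (S.power p t i ω * S.fade t i j ω * S.loss p i j ω) /
      (ENNReal.ofReal p.gamma * S.interference p t i j ω + ENNReal.ofReal p.noise)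
  else 0

/-- The first slot `t > 0` in which node `i` transmits successfully to its nearest neighbour in
its destination cone; it is `∞` if there is none. -/
def exitTime (S : Network Ω m) (p : SINRParams) (i : ℕ) (ω : Ω) : ℝ≥0∞ :=
  ⨅ (t : ℕ) (_ : 0 < t ∧ ENNReal.ofReal p.beta < S.sinr p t i (S.nn t i ω) ω), (t : ℝ≥0∞)

/-- The information available just before the coins and the fading of slot `t` are drawn: all
node positions, the destination cones up to and including slot `t`, and the on/off states and
fading powers of the earlier slots. -/
abbrev history (S : Network Ω m) (t : ℕ) : MeasurableSpace Ω :=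
  (⨆ i, MeasurableSpace.comap (S.pos i) inferInstance) ⊔
  (⨆ (s) (_ : s ≤ t) (i), MeasurableSpace.comap (S.dest s i) ⊤) ⊔
  (⨆ (s) (_ : s < t) (i), MeasurableSpace.comap (S.isOn s i) ⊤) ⊔
  (⨆ (s) (_ : s < t) (i) (j), MeasurableSpace.comap (S.fade s i j) inferInstance)

end Network

/-- `S` is a realization, on the probability space `(Ω, Pr)`, of the network with parameters `p`
when the nodes form a point process with law `Q`; the node labelled `0` sits at `x`.
The destination cones are arbitrary: they may be random, dependent on each other and on the
node positions, and may depend on the past of the network. In each slot, conditionally on the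
history, the on/off states are independent, node `i` being on with its prescribed probability, and
the fading powers are independent exponential variables, independent of the on/off states. -/
structure IsNetwork {Ω : Type*} [MeasurableSpace Ω] {m : ℕ} (S : Network Ω m) (p : SINRParams)
    (Pr : Measure Ω) (Q : Measure PointConfig) (x : Plane) : Prop where
  config_law : HasLaw S.config Q Pr
  measurable_pos : ∀ i, Measurable (S.pos i)
  measurable_dest : ∀ t i, Measurable (S.dest t i)
  measurable_isOn : ∀ t i, Measurable (S.isOn t i)
  measurable_fade : ∀ t i j, Measurable (S.fade t i j)
  /-- the labels enumerate the nodes without repetition -/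
  pos_enum : ∀ᵐ ω ∂Pr, Function.Injective (fun i => S.pos i ω) ∧
    Set.range (fun i => S.pos i ω) = (S.config ω).points
  pos_zero : ∀ᵐ ω ∂Pr, S.pos 0 ω = x
  cond_law : ∀ (t : ℕ) (I : Finset ℕ) (b : ℕ → Bool) (J : Finset (ℕ × ℕ)) (A : ℕ × ℕ → Set ℝ),
    (∀ q, MeasurableSet (A q)) →
    Pr⟦{ω | (∀ i ∈ I, S.isOn t i ω = b i) ∧ ∀ q ∈ J, S.fade t q.1 q.2 ω ∈ A q} | S.history t⟧
      =ᵐ[Pr] fun ω =>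
        (∏ i ∈ I, if b i = true then S.txProb p t i ω else 1 - S.txProb p t i ω) *
          ∏ q ∈ J, (expMeasure p.mu).real (A q)

end

/-! The proof bounds the conditional success probability in a slot from below by a random variable
`V⁻¹`, where `V` depends on the node positions only: neither on the slot nor on the cone choices.
The chance that the first `n` slots fail is then at most the integral of `V` over the event that
slot `n + 1` brings the first success (`measure_le_setLIntegral_success`). These events are
disjoint, so summing over `n` gives that the mean exit time is at most the mean of `V`
(`lintegral_exitTime_le`). No independence between slots is needed.

The bound in one slot: ask that node `0` be on, its receiver off, and the signal fading exceed a
level `n`. Power control cancels the path loss of the signal, and the mean power emitted by any node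
is at most `M`, so the conditional mean interference is at most a constant times the path-loss shot
noise at the receiver. By Markov's inequality the interference is at most about twice this mean with
probability at least one half, and a level `n` of that order suffices for success
(`half_lintegral_le_measure_success`). Hence the inverse success probability is at most a constant
times the inverse path loss to the receiver times an exponential of the shot noise there.

The receiver depends on an arbitrary cone choice, so this is dominated by a sum over all cones and
all lattice cells that could contain the receiver, each term restricted to the event that a ball
inside the cone is empty (`voidSum`, `regular_and_invSuccessBound_le`). Its Palm mean is reduced to
a Poisson mean by the Campbell formula over a unit square. There Cauchy–Schwarz separates the void
probability, Gaussian in the distance of the cell, from an exponential moment of shot noise, which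
is bounded uniformly in the cell because `α > 2` makes the path loss summable on the lattice
(`lintegral_void_mul_exp_tsum_count_le`, `IsPalmLaw.lintegral_voidSum_lt_top`). -/

/-! ### Measurability of the network quantities -/

theorem measurableSet_cone (m : ℕ) (k : Fin m) : MeasurableSet (cone m k) := by
  set a := (2 * (k : ℝ) - 1) * (Real.pi / m)
  set b := (2 * (k : ℝ) + 1) * (Real.pi / m)
  have h1 : cone m k = (fun q : ℝ × ℝ => (!₂[q.1 * Real.cos q.2, q.1 * Real.sin q.2] : Plane)) ''
      (Set.Ioi 0 ×ˢ Set.Ico a b) := by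
    ext v
    constructor
    · rintro ⟨r, θ, hr, h1, h2, rfl⟩
      exact ⟨(r, θ), ⟨hr, h1, h2⟩, rfl⟩
    · rintro ⟨⟨r, θ⟩, ⟨hr, h1, h2⟩, rfl⟩
      exact ⟨r, θ, hr, h1, h2, rfl⟩
  have hc : Continuous fun q : ℝ × ℝ =>
      (!₂[q.1 * Real.cos q.2, q.1 * Real.sin q.2] : Plane) := by
    refine (PiLp.continuous_toLp 2 _).comp ?_
    refine continuous_pi fun i => ?_
    fin_cases i <;> simp <;> fun_prop
  -- A locally closed subset of the plane is σ-compact, hence so is its continuous image, and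
  -- σ-compact sets are Borel.
  have hlc : IsLocallyClosed (Set.Ioi (0 : ℝ) ×ˢ Set.Ico a b) :=
    (isOpen_Ioi.isLocallyClosed.preimage continuous_fst).inter
      (isLocallyClosed_Ico.preimage continuous_snd)
  have : LocallyCompactSpace ↥(Set.Ioi (0 : ℝ) ×ˢ Set.Ico a b) := hlc.locallyCompactSpace
  have hs : IsSigmaCompact (Set.Ioi (0 : ℝ) ×ˢ Set.Ico a b) :=
    isSigmaCompact_iff_sigmaCompactSpace.mpr inferInstance
  obtain ⟨K, hK, hKu⟩ := hs.image hc
  rw [h1, ← hKu]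
  exact MeasurableSet.iUnion fun n => (hK n).measurableSet

theorem measurable_pathLoss (α : ℝ) : Measurable (pathLoss α) := by
  unfold pathLoss
  fun_prop

theorem pathLoss_le_one (α r : ℝ) : pathLoss α r ≤ 1 := min_le_right _ _

theorem pathLoss_nonneg (α : ℝ) {r : ℝ} (hr : 0 ≤ r) : 0 ≤ pathLoss α r :=
  le_min (Real.rpow_nonneg hr _) zero_le_one

theorem pathLoss_pos (α : ℝ) {r : ℝ} (hr : 0 < r) : 0 < pathLoss α r :=
  lt_min (Real.rpow_pos_of_pos hr _) zero_lt_one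

/-- Needed because the receiver's label is itself random: countability of the labels replaces joint
measurability. -/
theorem measurable_of_countable_choice {Ω β ι : Type*} [MeasurableSpace Ω] [MeasurableSpace β]
    [Countable ι] [MeasurableSpace ι] [MeasurableSingletonClass ι]
    {f : ι → Ω → β} (hf : ∀ i, Measurable (f i)) {g : Ω → ι} (hg : Measurable g) :
    Measurable fun ω => f (g ω) ω :=
  (measurable_from_prod_countable_right (f := fun q : ι × Ω => f q.1 q.2) hf).comp
    (hg.prodMk measurable_id)

theorem measurable_sInf_nat {Ω : Type*} [MeasurableSpace Ω] {B : ℕ → Ω → Prop}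
    (hB : ∀ j, MeasurableSet {ω | B j ω}) : Measurable fun ω => sInf {j | B j ω} := by
  classical
  refine measurable_to_countable' fun n => ?_
  have : (fun ω => sInf {j | B j ω}) ⁻¹' {n} =
      {ω | (B n ω ∧ ∀ k, k < n → ¬ B k ω) ∨ (n = 0 ∧ ∀ k, ¬ B k ω)} := by
    ext ω
    simp only [Set.mem_preimage, Set.mem_singleton_iff, Set.mem_ofPred_eq]
    constructor
    · rintro rfl
      by_cases h : {j | B j ω}.Nonempty
      · exact Or.inl ⟨Nat.sInf_mem h, fun k hk => Nat.notMem_of_lt_sInf hk⟩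
      · rw [Set.not_nonempty_iff_eq_empty] at h
        refine Or.inr ⟨by rw [h, Nat.sInf_empty], fun k hk => ?_⟩
        exact (Set.ext_iff.mp h k).mp hk
    · rintro (⟨h1, h2⟩ | ⟨rfl, h⟩)
      · refine le_antisymm (Nat.sInf_le h1) ?_
        by_contra! hlt
        exact h2 _ hlt (Nat.sInf_mem (s := {j | B j ω}) ⟨n, h1⟩)
      · have : {j | B j ω} = ∅ := Set.eq_empty_iff_forall_notMem.mpr h
        rw [this, Nat.sInf_empty]
  rw [this]
  measurability

namespace Network

variable {Ω : Type*} {m : ℕ} {S : Network Ω m} (p : SINRParams) {t : ℕ}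

/-- The σ-algebra is left as a parameter here and below, so that the same lemmas serve both the
ambient σ-algebra and `S.history t`. -/
theorem measurableSet_isNearest [MeasurableSpace Ω] (hp : ∀ i, Measurable (S.pos i))
    (hd : ∀ i, Measurable (S.dest t i)) (i j : ℕ) :
    MeasurableSet {ω | S.IsNearest t i j ω} := by
  have hc : ∀ k, MeasurableSet {ω | S.pos k ω - S.pos i ω ∈ cone m (S.dest t i ω)} := by
    intro k
    have : {ω | S.pos k ω - S.pos i ω ∈ cone m (S.dest t i ω)} =
        ⋃ d : Fin m, {ω | S.dest t i ω = d} ∩ (fun ω => S.pos k ω - S.pos i ω) ⁻¹' cone m d := by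
      ext ω
      simp
    rw [this]
    exact MeasurableSet.iUnion fun d => (hd i (measurableSet_singleton d)).inter
      (((hp k).sub (hp i)) (measurableSet_cone m d))
  have : {ω | ∀ k, k ≠ i → S.pos k ω - S.pos i ω ∈ cone m (S.dest t i ω) →
      dist (S.pos i ω) (S.pos j ω) ≤ dist (S.pos i ω) (S.pos k ω)} =
      ⋂ (k : ℕ) (_ : k ≠ i), {ω | S.pos k ω - S.pos i ω ∈ cone m (S.dest t i ω)}ᶜ ∪
        {ω | dist (S.pos i ω) (S.pos j ω) ≤ dist (S.pos i ω) (S.pos k ω)} := by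
    ext ω
    simp [imp_iff_not_or]
  refine (MeasurableSet.const _).inter ((hc j).inter ?_)
  refine (congrArg MeasurableSet this).mpr
    (MeasurableSet.iInter fun k => MeasurableSet.iInter fun _ => ?_)
  exact (hc k).compl.union (measurableSet_le ((hp i).dist (hp j)) ((hp i).dist (hp k)))

theorem measurable_nn [MeasurableSpace Ω] (hp : ∀ i, Measurable (S.pos i))
    (hd : ∀ i, Measurable (S.dest t i)) (i : ℕ) : Measurable (S.nn t i) :=
  measurable_sInf_nat fun j => measurableSet_isNearest hp hd i j

theorem measurable_loss [MeasurableSpace Ω] (hp : ∀ i, Measurable (S.pos i)) (i j : ℕ) :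
    Measurable (S.loss p i j) :=
  (measurable_pathLoss _).comp ((hp i).dist (hp j))

theorem measurable_power [MeasurableSpace Ω] (hp : ∀ i, Measurable (S.pos i))
    (hd : ∀ i, Measurable (S.dest t i)) (i : ℕ) : Measurable (S.power p t i) :=
  ((measurable_of_countable_choice (measurable_loss p hp i)
    (measurable_nn hp hd i)).inv).const_mul _

theorem measurable_txProb [MeasurableSpace Ω] (hp : ∀ i, Measurable (S.pos i))
    (hd : ∀ i, Measurable (S.dest t i)) (i : ℕ) : Measurable (S.txProb p t i) :=
  ((measurable_power p hp hd i).inv).const_mul _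

theorem measurable_interference [MeasurableSpace Ω] (hp : ∀ i, Measurable (S.pos i))
    (hd : ∀ i, Measurable (S.dest t i)) (ho : ∀ i, Measurable (S.isOn t i))
    (hf : ∀ i j, Measurable (S.fade t i j)) (i j : ℕ) :
    Measurable (S.interference p t i j) := by
  refine Measurable.tsum fun z => Measurable.ite ?_ ?_ measurable_const
  · exact (MeasurableSet.const _).inter ((MeasurableSet.const _).inter
      (ho z (measurableSet_singleton true)))
  · exact (((measurable_power p hp hd z).mul (hf z j)).mul (measurable_loss p hp z j)).ennreal_ofReal

theorem measurable_sinr [MeasurableSpace Ω] (hp : ∀ i, Measurable (S.pos i))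
    (hd : ∀ i, Measurable (S.dest t i)) (ho : ∀ i, Measurable (S.isOn t i))
    (hf : ∀ i j, Measurable (S.fade t i j)) (i j : ℕ) :
    Measurable (S.sinr p t i j) := by
  refine Measurable.ite ?_ ?_ measurable_const
  · exact (ho i (measurableSet_singleton true)).inter (ho j (measurableSet_singleton false))
  · exact (((measurable_power p hp hd i).mul (hf i j)).mul
      (measurable_loss p hp i j)).ennreal_ofReal.div
      (((measurable_interference p hp hd ho hf i j).const_mul _).add_const _)

/-- The event that node `0` transmits successfully to its nearest neighbour in slot `t`. -/
def success (S : Network Ω m) (p : SINRParams) (t : ℕ) : Set Ω :=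
  {ω | ENNReal.ofReal p.beta < S.sinr p t 0 (S.nn t 0 ω) ω}

theorem measurableSet_success [MeasurableSpace Ω] (hp : ∀ i, Measurable (S.pos i))
    (hd : ∀ i, Measurable (S.dest t i)) (ho : ∀ i, Measurable (S.isOn t i))
    (hf : ∀ i j, Measurable (S.fade t i j)) : MeasurableSet (S.success p t) :=
  measurableSet_lt measurable_const
    (measurable_of_countable_choice (measurable_sinr p hp hd ho hf 0) (measurable_nn hp hd 0))

theorem measurable_pos_history (S : Network Ω m) (t i : ℕ) : Measurable[S.history t] (S.pos i) :=
  Measurable.mono (comap_measurable _)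
    ((le_iSup (fun i => MeasurableSpace.comap (S.pos i) inferInstance) i).trans
      (le_sup_left.trans (le_sup_left.trans le_sup_left))) le_rfl

theorem measurable_dest_history (S : Network Ω m) {s t : ℕ} (h : s ≤ t) (i : ℕ) :
    Measurable[S.history t] (S.dest s i) :=
  Measurable.mono (comap_measurable _)
    ((le_iSup₂_of_le (f := fun s (_ : s ≤ t) => ⨆ i, MeasurableSpace.comap (S.dest s i) ⊤) s h
      (le_iSup (fun i => MeasurableSpace.comap (S.dest s i) ⊤) i)).trans
      (le_sup_right.trans (le_sup_left.trans le_sup_left))) le_rfl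

theorem measurable_isOn_history (S : Network Ω m) {s t : ℕ} (h : s < t) (i : ℕ) :
    Measurable[S.history t] (S.isOn s i) :=
  Measurable.mono (comap_measurable _)
    ((le_iSup₂_of_le (f := fun s (_ : s < t) => ⨆ i, MeasurableSpace.comap (S.isOn s i) ⊤) s h
      (le_iSup (fun i => MeasurableSpace.comap (S.isOn s i) ⊤) i)).trans
      (le_sup_right.trans le_sup_left)) le_rfl

theorem measurable_fade_history (S : Network Ω m) {s t : ℕ} (h : s < t) (i j : ℕ) :
    Measurable[S.history t] (S.fade s i j) :=
  Measurable.mono (comap_measurable _)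
    ((le_iSup₂_of_le
      (f := fun s (_ : s < t) => ⨆ i, ⨆ j, MeasurableSpace.comap (S.fade s i j) inferInstance) s h
      (le_iSup_of_le i (le_iSup (fun j => MeasurableSpace.comap (S.fade s i j) inferInstance) j))).trans
      le_sup_right) le_rfl

theorem measurableSet_success_history (S : Network Ω m) {s t : ℕ} (h : s < t) :
    MeasurableSet[S.history t] (S.success p s) :=
  @measurableSet_success Ω m S p s (S.history t) (S.measurable_pos_history t)
    (S.measurable_dest_history h.le) (S.measurable_isOn_history h) (S.measurable_fade_history h)

theorem measurable_exitTime [MeasurableSpace Ω] (hp : ∀ i, Measurable (S.pos i))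
    (hd : ∀ t i, Measurable (S.dest t i)) (ho : ∀ t i, Measurable (S.isOn t i))
    (hf : ∀ t i j, Measurable (S.fade t i j)) : Measurable (S.exitTime p 0) := by
  classical
  have : S.exitTime p 0 = fun ω => ⨅ t : ℕ, if 0 < t ∧ ω ∈ S.success p t then (t : ℝ≥0∞) else ∞ := by
    funext ω
    unfold exitTime
    congr 1
    funext t
    change (⨅ _ : 0 < t ∧ ω ∈ S.success p t, (t : ℝ≥0∞)) = _
    by_cases h : 0 < t ∧ ω ∈ S.success p t
    · rw [if_pos h, iInf_pos h]
    · rw [if_neg h, iInf_neg h]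
  rw [this]
  refine Measurable.iInf fun t => Measurable.ite ?_ measurable_const measurable_const
  exact (MeasurableSet.const _).inter (measurableSet_success p hp (hd t) (ho t) (hf t))

end Network

/-! ### One slot, conditionally on the history -/

namespace IsNetwork

variable {Ω : Type*} [mΩ : MeasurableSpace Ω] {m : ℕ} {S : Network Ω m} {p : SINRParams}
  {Pr : Measure Ω} {Q : Measure PointConfig} {x : Plane}

theorem history_le (h : IsNetwork S p Pr Q x) (t : ℕ) : S.history t ≤ mΩ := by
  refine sup_le (sup_le (sup_le ?_ ?_) ?_) ?_
  · exact iSup_le fun i => (h.measurable_pos i).comap_le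
  · exact iSup_le fun s => iSup_le fun _ => iSup_le fun i => (h.measurable_dest s i).comap_le
  · exact iSup_le fun s => iSup_le fun _ => iSup_le fun i => (h.measurable_isOn s i).comap_le
  · exact iSup_le fun s => iSup_le fun _ => iSup_le fun i => iSup_le fun j =>
      (h.measurable_fade s i j).comap_le

end IsNetwork

namespace Network

variable {Ω : Type*} {m : ℕ} (S : Network Ω m) (p : SINRParams) (t : ℕ)

theorem loss_nonneg (i j : ℕ) (ω : Ω) : 0 ≤ S.loss p i j ω := pathLoss_nonneg _ dist_nonneg

theorem loss_le_one (i j : ℕ) (ω : Ω) : S.loss p i j ω ≤ 1 := pathLoss_le_one _ _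

variable {p}

theorem txProb_eq (hM : 0 < p.avgPower) (i : ℕ) (ω : Ω) :
    S.txProb p t i ω = (1 - p.eps) * S.loss p i (S.nn t i ω) ω := by
  unfold txProb power SINRParams.c
  rw [mul_inv, mul_inv, inv_inv, inv_inv, ← mul_assoc, ← mul_assoc, mul_inv_cancel₀ hM.ne', one_mul]

theorem txProb_nonneg (hM : 0 < p.avgPower) (he : p.eps < 1) (i : ℕ) (ω : Ω) :
    0 ≤ S.txProb p t i ω := by
  rw [S.txProb_eq t hM]
  exact mul_nonneg (sub_nonneg.mpr he.le) (S.loss_nonneg p _ _ _)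

theorem txProb_le (hM : 0 < p.avgPower) (he : p.eps < 1) (i : ℕ) (ω : Ω) :
    S.txProb p t i ω ≤ 1 - p.eps := by
  rw [S.txProb_eq t hM]
  exact mul_le_of_le_one_right (sub_nonneg.mpr he.le) (S.loss_le_one p _ _ _)

theorem power_nonneg (hM : 0 < p.avgPower) (he : p.eps < 1) (i : ℕ) (ω : Ω) :
    0 ≤ S.power p t i ω :=
  mul_nonneg (mul_nonneg hM.le (inv_nonneg.mpr (sub_nonneg.mpr he.le)))
    (inv_nonneg.mpr (S.loss_nonneg p _ _ _))

/-- This is the point of the power control: the mean emitted power has a bound free of the cone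
choices. It is an inequality because `a * a⁻¹` is `0` when the power vanishes. -/
theorem power_mul_txProb_le (hM : 0 < p.avgPower) (i : ℕ) (ω : Ω) :
    S.power p t i ω * S.txProb p t i ω ≤ p.avgPower := by
  unfold txProb
  rw [mul_left_comm]
  exact mul_le_of_le_one_right hM.le mul_inv_le_one

/-- The event that the nodes in `I` have the on/off states `b` and the fading powers indexed by
`J` lie in the sets `A`. -/
def slotEvent (t : ℕ) (I : Finset ℕ) (b : ℕ → Bool) (J : Finset (ℕ × ℕ)) (A : ℕ × ℕ → Set ℝ) :
    Set Ω :=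
  {ω | (∀ i ∈ I, S.isOn t i ω = b i) ∧ ∀ q ∈ J, S.fade t q.1 q.2 ω ∈ A q}

/-- The conditional probability, given the history, that the nodes in `I` have the on/off
states `b`. -/
noncomputable def stateProb (p : SINRParams) (t : ℕ) (I : Finset ℕ) (b : ℕ → Bool) (ω : Ω) : ℝ :=
  ∏ i ∈ I, if b i = true then S.txProb p t i ω else 1 - S.txProb p t i ω

theorem stateProb_nonneg (hM : 0 < p.avgPower) (he0 : 0 < p.eps) (he : p.eps < 1)
    (I : Finset ℕ) (b : ℕ → Bool) (ω : Ω) : 0 ≤ S.stateProb p t I b ω := by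
  refine Finset.prod_nonneg fun i _ => ?_
  have h1 := S.txProb_nonneg t hM he i ω
  have h2 := S.txProb_le t hM he i ω
  split_ifs <;> linarith

theorem measurable_stateProb (I : Finset ℕ)
    (b : ℕ → Bool) : Measurable[S.history t] (S.stateProb p t I b) := by
  have key : ∀ i, Measurable[S.history t] (S.txProb p t i) :=
    @Network.measurable_txProb Ω m S p t (S.history t) (S.measurable_pos_history t)
      (S.measurable_dest_history le_rfl)
  let _ := S.history t
  refine Finset.measurable_fun_prod _ fun i _ => ?_
  split_ifs
  · exact key i
  · exact (key i).const_sub 1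

end Network

namespace IsNetwork

variable {Ω : Type*} [mΩ : MeasurableSpace Ω] {m : ℕ} {S : Network Ω m} {p : SINRParams}
  {Pr : Measure Ω} {Q : Measure PointConfig} {x : Plane}

theorem measurableSet_slotEvent (h : IsNetwork S p Pr Q x) (t : ℕ) (I : Finset ℕ) (b : ℕ → Bool)
    (J : Finset (ℕ × ℕ)) {A : ℕ × ℕ → Set ℝ} (hA : ∀ q, MeasurableSet (A q)) :
    MeasurableSet (S.slotEvent t I b J A) := by
  have : S.slotEvent t I b J A = (⋂ i ∈ I, S.isOn t i ⁻¹' {b i}) ∩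
      ⋂ q ∈ J, S.fade t q.1 q.2 ⁻¹' A q := by
    ext ω
    simp [Network.slotEvent]
  rw [this]
  exact (MeasurableSet.biInter I.countable_toSet fun i _ =>
    h.measurable_isOn t i (measurableSet_singleton _)).inter
    (MeasurableSet.biInter J.countable_toSet fun q _ => h.measurable_fade t q.1 q.2 (hA q))

variable [IsProbabilityMeasure Pr]

/-- The integrated form of `cond_law`, moved to `ℝ≥0∞` so that later steps carry no integrability
conditions. -/
theorem measure_inter_slotEvent (h : IsNetwork S p Pr Q x) (hμ : 0 < p.mu)
    (hM : 0 < p.avgPower) (he0 : 0 < p.eps) (he : p.eps < 1) (t : ℕ)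
    (I : Finset ℕ) (b : ℕ → Bool) (J : Finset (ℕ × ℕ)) {A : ℕ × ℕ → Set ℝ}
    (hA : ∀ q, MeasurableSet (A q)) {H : Set Ω} (hH : MeasurableSet[S.history t] H) :
    Pr (H ∩ S.slotEvent t I b J A) =
      ∫⁻ ω in H, ENNReal.ofReal (S.stateProb p t I b ω) * ∏ q ∈ J, expMeasure p.mu (A q) ∂Pr := by
  have := isProbabilityMeasure_expMeasure hμ
  have hE := h.measurableSet_slotEvent t I b J hA
  have hle := h.history_le t
  have hc := h.cond_law t I b J A hA
  set E := S.slotEvent t I b J A with hEdef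
  set R : Ω → ℝ := fun ω => S.stateProb p t I b ω * ∏ q ∈ J, (expMeasure p.mu).real (A q)
  have hc' : Pr⟦E | S.history t⟧ =ᵐ[Pr] R := hc
  have hRint : Integrable R Pr := integrable_condExp.congr hc'
  have hR0 : ∀ ω, 0 ≤ R ω := fun ω => mul_nonneg (S.stateProb_nonneg t hM he0 he I b ω)
    (Finset.prod_nonneg fun _ _ => measureReal_nonneg)
  have h1 : ∫ ω in H, R ω ∂Pr = Pr.real (H ∩ E) := by
    rw [← setIntegral_congr_ae₀ (hle _ hH).nullMeasurableSet (hc'.mono fun ω hω _ => hω),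
      setIntegral_condExp hle ((integrable_const _).indicator hE) hH,
      setIntegral_indicator hE]
    simp
  rw [← ofReal_measureReal, ← h1,
    ofReal_integral_eq_lintegral_ofReal hRint.integrableOn (ae_of_all _ hR0)]
  refine lintegral_congr fun ω => ?_
  rw [ENNReal.ofReal_mul (S.stateProb_nonneg t hM he0 he I b ω),
    ENNReal.ofReal_prod_of_nonneg fun _ _ => measureReal_nonneg]
  congr 1
  exact Finset.prod_congr rfl fun _ _ => ofReal_measureReal

/-- The previous lemma says that two measures agree on the history σ-algebra; integrals of
history-measurable functions therefore agree too. -/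
theorem lintegral_slotEvent (h : IsNetwork S p Pr Q x) (hμ : 0 < p.mu)
    (hM : 0 < p.avgPower) (he0 : 0 < p.eps) (he : p.eps < 1) (t : ℕ)
    (I : Finset ℕ) (b : ℕ → Bool) (J : Finset (ℕ × ℕ)) {A : ℕ × ℕ → Set ℝ}
    (hA : ∀ q, MeasurableSet (A q)) {f : Ω → ℝ≥0∞} (hf : Measurable[S.history t] f) :
    ∫⁻ ω in S.slotEvent t I b J A, f ω ∂Pr =
      (∫⁻ ω, f ω * ENNReal.ofReal (S.stateProb p t I b ω) ∂Pr) *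
        ∏ q ∈ J, expMeasure p.mu (A q) := by
  have := isProbabilityMeasure_expMeasure hμ
  have hle := h.history_le t
  have hD : Measurable fun ω => ENNReal.ofReal (S.stateProb p t I b ω) *
      ∏ q ∈ J, expMeasure p.mu (A q) :=
    (((S.measurable_stateProb t I b).mono hle le_rfl).ennreal_ofReal).mul_const _
  have hm : (Pr.restrict (S.slotEvent t I b J A)).trim hle =
      (Pr.withDensity fun ω => ENNReal.ofReal (S.stateProb p t I b ω) *
        ∏ q ∈ J, expMeasure p.mu (A q)).trim hle := by
    refine @Measure.ext _ (S.history t) _ _ fun H hH => ?_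
    rw [trim_measurableSet_eq hle hH, trim_measurableSet_eq hle hH,
      Measure.restrict_apply (hle _ hH), withDensity_apply _ (hle _ hH),
      h.measure_inter_slotEvent hμ hM he0 he t I b J hA hH]
  rw [← lintegral_trim hle hf, hm, lintegral_trim hle hf,
    lintegral_withDensity_eq_lintegral_mul _ hD (hf.mono hle le_rfl),
    ← lintegral_mul_const _ (f := fun ω => f ω * ENNReal.ofReal (S.stateProb p t I b ω))
      ((hf.mono hle le_rfl).mul
      ((S.measurable_stateProb t I b).mono hle le_rfl).ennreal_ofReal)]
  refine lintegral_congr fun ω => ?_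
  simp only [Pi.mul_apply]
  ring

/-- Adding the fresh pair `q` to `J` shows that under the measure with density `f` on the slot
event, the fading of `q` is distributed as a multiple of the exponential law. The mean of the fading
then factors out. -/
theorem lintegral_slotEvent_mul_fade (h : IsNetwork S p Pr Q x) (hμ : 0 < p.mu)
    (hM : 0 < p.avgPower) (he0 : 0 < p.eps) (he : p.eps < 1) (t : ℕ)
    (I : Finset ℕ) (b : ℕ → Bool) (J : Finset (ℕ × ℕ)) {A : ℕ × ℕ → Set ℝ}
    (hA : ∀ q, MeasurableSet (A q)) {f : Ω → ℝ≥0∞} (hf : Measurable[S.history t] f)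
    {q : ℕ × ℕ} (hq : q ∉ J) :
    ∫⁻ ω in S.slotEvent t I b J A, f ω * ENNReal.ofReal (S.fade t q.1 q.2 ω) ∂Pr =
      ((∫⁻ ω, f ω * ENNReal.ofReal (S.stateProb p t I b ω) ∂Pr) *
        ∏ q ∈ J, expMeasure p.mu (A q)) * ∫⁻ s, ENNReal.ofReal s ∂(expMeasure p.mu) := by
  have hle := h.history_le t
  have hf' := hf.mono hle le_rfl
  have hE := h.measurableSet_slotEvent t I b J hA
  have hm : (((Pr.withDensity f).restrict (S.slotEvent t I b J A)).map (S.fade t q.1 q.2)) =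
      ((∫⁻ ω, f ω * ENNReal.ofReal (S.stateProb p t I b ω) ∂Pr) *
        ∏ q ∈ J, expMeasure p.mu (A q)) • expMeasure p.mu := by
    ext A' hA'
    have hev : S.fade t q.1 q.2 ⁻¹' A' ∩ S.slotEvent t I b J A =
        S.slotEvent t I b (insert q J) (Function.update A q A') := by
      ext ω
      have : ∀ r ∈ J, Function.update A q A' r = A r := fun r hr =>
        Function.update_of_ne (ne_of_mem_of_not_mem hr hq) _ _
      simp only [Network.slotEvent, Set.mem_inter_iff, Set.mem_preimage, Set.mem_ofPred_eq,
        Finset.forall_mem_insert, Function.update_self]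
      constructor
      · rintro ⟨h1, h2, h3⟩
        exact ⟨h2, h1, fun r hr => by rw [this r hr]; exact h3 r hr⟩
      · rintro ⟨h2, h1, h3⟩
        exact ⟨h1, h2, fun r hr => by rw [← this r hr]; exact h3 r hr⟩
    have hA2 : ∀ r, MeasurableSet (Function.update A q A' r) := by
      intro r
      rcases eq_or_ne r q with rfl | hr
      · rwa [Function.update_self]
      · rw [Function.update_of_ne hr]; exact hA r
    rw [Measure.map_apply (h.measurable_fade t q.1 q.2) hA',
      Measure.restrict_apply (h.measurable_fade t q.1 q.2 hA'),
      withDensity_apply _ ((h.measurable_fade t q.1 q.2 hA').inter hE), hev,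
      h.lintegral_slotEvent hμ hM he0 he t I b _ hA2 hf, Finset.prod_insert hq,
      Function.update_self, Measure.smul_apply, smul_eq_mul, mul_assoc]
    congr 1
    rw [mul_comm]
    congr 1
    exact Finset.prod_congr rfl fun r hr => by
      rw [Function.update_of_ne (ne_of_mem_of_not_mem hr hq)]
  rw [← smul_eq_mul, ← lintegral_smul_measure, ← hm,
    lintegral_map ENNReal.measurable_ofReal (h.measurable_fade t q.1 q.2),
    setLIntegral_withDensity_eq_setLIntegral_mul _ hf'
      (h.measurable_fade t q.1 q.2).ennreal_ofReal hE]
  rfl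

end IsNetwork

/-! ### The conditional success probability, by Markov's inequality -/

theorem ENNReal.half_le_of_le_half_add {a b : ℝ≥0∞} (ha : a ≠ ∞) (h : a ≤ a / 2 + b) : a / 2 ≤ b := by
  have h2 : a / 2 ≠ ∞ := (ENNReal.half_le_self.trans_lt ha.lt_top).ne
  refine (ENNReal.add_le_add_iff_left h2).mp ?_
  rwa [ENNReal.add_halves]

theorem mean_expMeasure_lt_top {μ : ℝ} (hμ : 0 < μ) :
    ∫⁻ s, ENNReal.ofReal s ∂(expMeasure μ) < ∞ := by
  have hint := integrableOn_rpow_mul_exp_neg_mul_rpow (s := 1) (p := 1) (b := μ)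
    (by norm_num) one_pos hμ
  have hm : Measurable (exponentialPDF μ) := (measurable_exponentialPDFReal μ).ennreal_ofReal
  change ∫⁻ s, ENNReal.ofReal s ∂(volume.withDensity (exponentialPDF μ)) < ∞
  rw [lintegral_withDensity_eq_lintegral_mul _ hm ENNReal.measurable_ofReal]
  refine lt_of_le_of_lt ?_ (IntegrableOn.setLIntegral_lt_top (Integrable.const_mul hint μ))
  rw [← lintegral_indicator measurableSet_Ioi]
  refine lintegral_mono fun s => ?_
  by_cases hs : s ∈ Set.Ioi (0 : ℝ)
  · have hs' : 0 < s := hs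
    rw [Set.indicator_of_mem hs, Pi.mul_apply, exponentialPDF_of_nonneg hs'.le,
      ← ENNReal.ofReal_mul (by positivity), Real.rpow_one]
    refine ENNReal.ofReal_le_ofReal (le_of_eq ?_)
    rw [neg_mul]
    ring
  · rw [Pi.mul_apply, ENNReal.ofReal_of_nonpos (not_lt.mp hs), mul_zero]
    exact zero_le

theorem expMeasure_Ioi {μ : ℝ} (hμ : 0 < μ) {s : ℝ} (hs : 0 ≤ s) :
    expMeasure μ (Set.Ioi s) = ENNReal.ofReal (Real.exp (-(μ * s))) := by
  have := isProbabilityMeasure_expMeasure hμ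
  have h := cdf_expMeasure_eq hμ s
  rw [if_pos hs, cdf_eq_real] at h
  rw [← Set.compl_Iic, prob_compl_eq_one_sub measurableSet_Iic, ← ofReal_measureReal, h,
    ← ENNReal.ofReal_one, ← ENNReal.ofReal_sub _ (by
      have : Real.exp (-(μ * s)) ≤ 1 := Real.exp_le_one_iff.mpr (by nlinarith [mul_nonneg hμ.le hs])
      linarith)]
  congr 1
  ring

namespace IsNetwork

variable {Ω : Type*} [mΩ : MeasurableSpace Ω] {m : ℕ} {S : Network Ω m} {p : SINRParams}
  {Pr : Measure Ω} {Q : Measure PointConfig} {x : Plane} [IsProbabilityMeasure Pr]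

/-- Given the history, the coin of an interferer `z` and its fading towards `j` are independent of
the event that fixes node `0`, node `j` and the signal fading. So `z` contributes power times
transmission probability times loss times mean fading, and power control bounds the first product.
-/
theorem lintegral_slotEvent_interference_le (h : IsNetwork S p Pr Q x) (hμ : 0 < p.mu)
    (hM : 0 < p.avgPower) (he0 : 0 < p.eps) (he : p.eps < 1) (t n j : ℕ)
    {H : Set Ω} (hH : MeasurableSet[S.history t] H) :
    ∫⁻ ω in H ∩ S.slotEvent t {0, j} (fun i => decide (i ≠ j)) {(0, j)} (fun _ => Set.Ioi (n : ℝ)),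
        S.interference p t 0 j ω ∂Pr ≤
      ∫⁻ ω in H, (ENNReal.ofReal p.avgPower * (∑' z, ENNReal.ofReal (S.loss p z j ω)) *
        ∫⁻ s, ENNReal.ofReal s ∂(expMeasure p.mu)) *
        (ENNReal.ofReal (S.stateProb p t {0, j} (fun i => decide (i ≠ j)) ω) *
          expMeasure p.mu (Set.Ioi (n : ℝ))) ∂Pr := by
  classical
  have hle := h.history_le t
  set κ := ∫⁻ s, ENNReal.ofReal s ∂(expMeasure p.mu)
  -- Every label except the receiver is on, so the same `b` also describes the event enlarged by an
  -- active interferer `z`.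
  set b : ℕ → Bool := fun i => decide (i ≠ j)
  set A : ℕ × ℕ → Set ℝ := fun _ => Set.Ioi (n : ℝ)
  have hA : ∀ q, MeasurableSet (A q) := fun _ => measurableSet_Ioi
  set E := S.slotEvent t {0, j} b {(0, j)} A
  have hE : MeasurableSet E := h.measurableSet_slotEvent t _ _ _ hA
  set D : Ω → ℝ≥0∞ := fun ω => ENNReal.ofReal (S.stateProb p t {0, j} b ω) *
    expMeasure p.mu (Set.Ioi (n : ℝ))
  have hsp := fun I => (S.measurable_stateProb (p := p) t I b).mono hle le_rfl
  have hDm : Measurable D := (hsp _).ennreal_ofReal.mul_const _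
  have hloss : ∀ z, Measurable (S.loss p z j) := fun z =>
    Network.measurable_loss p h.measurable_pos z j
  have hpow : ∀ z, Measurable[S.history t] (S.power p t z) := fun z =>
    @Network.measurable_power Ω m S p t (S.history t) (S.measurable_pos_history t)
      (S.measurable_dest_history le_rfl) z
  have hlossH : ∀ z, Measurable[S.history t] (S.loss p z j) := fun z =>
    @Network.measurable_loss Ω m S p (S.history t) (S.measurable_pos_history t) z j
  have hterm : ∀ z, ∫⁻ ω in H ∩ E, (if z ≠ 0 ∧ z ≠ j ∧ S.isOn t z ω = true then
      ENNReal.ofReal (S.power p t z ω * S.fade t z j ω * S.loss p z j ω) else 0) ∂Pr ≤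
      ∫⁻ ω in H, ENNReal.ofReal p.avgPower * ENNReal.ofReal (S.loss p z j ω) * κ * D ω ∂Pr := by
    intro z
    by_cases hz : z ≠ 0 ∧ z ≠ j
    swap
    · have : ∀ ω, ¬ (z ≠ 0 ∧ z ≠ j ∧ S.isOn t z ω = true) := fun ω hc => hz ⟨hc.1, hc.2.1⟩
      simp only [this, if_false, lintegral_zero, zero_le]
    obtain ⟨hz0, hzj⟩ := hz
    have hz2 : z ∉ ({0, j} : Finset ℕ) := by simp [hz0, hzj]
    set f : Ω → ℝ≥0∞ := H.indicator fun ω =>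
      ENNReal.ofReal (S.power p t z ω) * ENNReal.ofReal (S.loss p z j ω)
    have hf : Measurable[S.history t] f :=
      (((hpow z).ennreal_ofReal).mul (hlossH z).ennreal_ofReal).indicator hH
    have hEz : S.slotEvent t (insert z {0, j}) b {(0, j)} A ⊆ E := fun ω hω =>
      ⟨fun i hi => hω.1 i (Finset.mem_insert_of_mem hi), hω.2⟩
    have h1 : ∫⁻ ω in H ∩ E, (if z ≠ 0 ∧ z ≠ j ∧ S.isOn t z ω = true then
        ENNReal.ofReal (S.power p t z ω * S.fade t z j ω * S.loss p z j ω) else 0) ∂Pr =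
        ∫⁻ ω in S.slotEvent t (insert z {0, j}) b {(0, j)} A,
          f ω * ENNReal.ofReal (S.fade t z j ω) ∂Pr := by
      rw [← lintegral_indicator ((hle _ hH).inter hE),
        ← lintegral_indicator (h.measurableSet_slotEvent t _ _ _ hA)]
      refine lintegral_congr fun ω => ?_
      by_cases hω : ω ∈ S.slotEvent t (insert z {0, j}) b {(0, j)} A
      · have hon : S.isOn t z ω = true := by
          rw [hω.1 z (Finset.mem_insert_self _ _)]; simp [b, hzj]
        rw [Set.indicator_of_mem hω]
        by_cases hωH : ω ∈ H
        · rw [Set.indicator_of_mem (show ω ∈ H ∩ E from ⟨hωH, hEz hω⟩), if_pos ⟨hz0, hzj, hon⟩]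
          simp only [f, Set.indicator_of_mem hωH]
          rw [ENNReal.ofReal_mul' (S.loss_nonneg p _ _ _),
            ENNReal.ofReal_mul (S.power_nonneg t hM he _ _)]
          ring
        · rw [Set.indicator_of_notMem (fun hc => hωH hc.1)]
          simp only [f, Set.indicator_of_notMem hωH, zero_mul]
      · rw [Set.indicator_of_notMem hω]
        by_cases hc : ω ∈ H ∩ E
        · rw [Set.indicator_of_mem hc, if_neg]
          rintro ⟨-, -, hon⟩
          refine hω ⟨fun i hi => ?_, hc.2.2⟩
          rcases Finset.mem_insert.mp hi with rfl | hi
          · rw [hon]; simp [b, hzj]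
          · exact hc.2.1 i hi
        · rw [Set.indicator_of_notMem hc]
    have hq : ((z, j) : ℕ × ℕ) ∉ ({(0, j)} : Finset (ℕ × ℕ)) := by simp [hz0]
    have hfs : Measurable fun ω =>
        f ω * ENNReal.ofReal (S.stateProb p t (insert z {0, j}) b ω) :=
      (hf.mono hle le_rfl).mul (hsp _).ennreal_ofReal
    rw [h1, h.lintegral_slotEvent_mul_fade hμ hM he0 he t _ b _ hA hf hq,
      Finset.prod_singleton, ← lintegral_indicator (hle _ hH),
      ← lintegral_mul_const _ hfs, ← lintegral_mul_const _ (hfs.mul_const _)]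
    refine lintegral_mono fun ω => ?_
    by_cases hωH : ω ∈ H
    swap
    · simp [f, hωH]
    simp only [f, Set.indicator_of_mem hωH, D]
    have hs : S.stateProb p t (insert z {0, j}) b ω =
        S.txProb p t z ω * S.stateProb p t {0, j} b ω := by
      unfold Network.stateProb
      rw [Finset.prod_insert hz2, if_pos (by simp [b, hzj])]
    rw [hs, ENNReal.ofReal_mul (S.txProb_nonneg t hM he _ _)]
    have hpm : ENNReal.ofReal (S.power p t z ω) * ENNReal.ofReal (S.txProb p t z ω) ≤
        ENNReal.ofReal p.avgPower := by
      rw [← ENNReal.ofReal_mul (S.power_nonneg t hM he _ _)]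
      exact ENNReal.ofReal_le_ofReal (S.power_mul_txProb_le t hM z ω)
    calc _ = (ENNReal.ofReal (S.power p t z ω) * ENNReal.ofReal (S.txProb p t z ω)) *
          (ENNReal.ofReal (S.loss p z j ω) * κ *
          (ENNReal.ofReal (S.stateProb p t {0, j} b ω) * expMeasure p.mu (Set.Ioi (n : ℝ)))) := by
          ring
      _ ≤ ENNReal.ofReal p.avgPower * (ENNReal.ofReal (S.loss p z j ω) * κ *
          (ENNReal.ofReal (S.stateProb p t {0, j} b ω) * expMeasure p.mu (Set.Ioi (n : ℝ)))) := by
          gcongr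
      _ = _ := by ring
  calc _ = ∑' z, ∫⁻ ω in H ∩ E, (if z ≠ 0 ∧ z ≠ j ∧ S.isOn t z ω = true then
        ENNReal.ofReal (S.power p t z ω * S.fade t z j ω * S.loss p z j ω) else 0) ∂Pr := by
        refine lintegral_tsum fun z => (Measurable.ite ?_ ?_ measurable_const).aemeasurable
        · exact (MeasurableSet.const _).inter ((MeasurableSet.const _).inter
            (h.measurable_isOn t z (measurableSet_singleton true)))
        · exact ((((hpow z).mono hle le_rfl).mul (h.measurable_fade t z j)).mul
            (hloss z)).ennreal_ofReal
    _ ≤ ∑' z, ∫⁻ ω in H, ENNReal.ofReal p.avgPower * ENNReal.ofReal (S.loss p z j ω) * κ * D ω ∂Pr :=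
        ENNReal.tsum_le_tsum hterm
    _ = ∫⁻ ω in H, ∑' z, ENNReal.ofReal p.avgPower * ENNReal.ofReal (S.loss p z j ω) * κ * D ω ∂Pr :=
        (lintegral_tsum fun z =>
          ((((hloss z).ennreal_ofReal.const_mul _).mul_const _).mul hDm).aemeasurable).symm
    _ = _ := by
        refine lintegral_congr fun ω => ?_
        rw [ENNReal.tsum_mul_right, ENNReal.tsum_mul_right, ENNReal.tsum_mul_left]

/-- Conditional success probability: on an event `H` of the history on which node `j` is the
receiver and twice the mean weighted interference fits into the threshold given by `n`. -/
theorem half_lintegral_le_measure_success (h : IsNetwork S p Pr Q x) (hμ : 0 < p.mu)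
    (hM : 0 < p.avgPower) (he0 : 0 < p.eps) (he : p.eps < 1) (hβ : 0 < p.beta) (t n : ℕ) {j : ℕ} (hj : j ≠ 0)
    {H : Set Ω} (hH : MeasurableSet[S.history t] H) (hnn : ∀ ω ∈ H, S.nn t 0 ω = j)
    (hloss : ∀ ω ∈ H, 0 < S.loss p 0 j ω)
    (hn : ∀ ω ∈ H, 2 * (ENNReal.ofReal (p.beta * p.gamma) * (ENNReal.ofReal p.avgPower *
      (∑' z, ENNReal.ofReal (S.loss p z j ω)) * ∫⁻ s, ENNReal.ofReal s ∂(expMeasure p.mu))) +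
      ENNReal.ofReal (p.beta * p.noise) < ENNReal.ofReal (p.c * n)) :
    (∫⁻ ω in H, ENNReal.ofReal (S.txProb p t 0 ω * (1 - S.txProb p t j ω)) *
        ENNReal.ofReal (Real.exp (-(p.mu * n))) ∂Pr) / 2 ≤ Pr (H ∩ S.success p t) := by
  rcases H.eq_empty_or_nonempty with rfl | hHne
  · simp
  have hle := h.history_le t
  have hc : 0 < p.c := mul_pos hM (inv_pos.mpr (sub_pos.mpr he))
  have hI := h.lintegral_slotEvent_interference_le hμ hM he0 he t n j hH
  set κ := ∫⁻ s, ENNReal.ofReal s ∂(expMeasure p.mu)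
  set b : ℕ → Bool := fun i => decide (i ≠ j)
  set A : ℕ × ℕ → Set ℝ := fun _ => Set.Ioi (n : ℝ)
  have hA : ∀ q, MeasurableSet (A q) := fun _ => measurableSet_Ioi
  set E := S.slotEvent t {0, j} b {(0, j)} A
  have hE : MeasurableSet E := h.measurableSet_slotEvent t _ _ _ hA
  have hsp : ∀ ω, S.stateProb p t {0, j} b ω = S.txProb p t 0 ω * (1 - S.txProb p t j ω) := by
    intro ω
    unfold Network.stateProb
    rw [Finset.prod_pair hj.symm]
    simp [b, hj.symm]
  have hPE : Pr (H ∩ E) = ∫⁻ ω in H, ENNReal.ofReal (S.txProb p t 0 ω * (1 - S.txProb p t j ω)) *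
      ENNReal.ofReal (Real.exp (-(p.mu * n))) ∂Pr := by
    rw [h.measure_inter_slotEvent hμ hM he0 he t _ b _ hA hH]
    simp only [hsp, Finset.prod_singleton, A, expMeasure_Ioi hμ (Nat.cast_nonneg n)]
  rw [← hPE]
  -- The room left for the weighted interference once the noise is paid: success follows on `E` as
  -- soon as `Y < R`.
  set R := ENNReal.ofReal (p.c * n) - ENNReal.ofReal (p.beta * p.noise) with hR
  have hR0 : R ≠ 0 := by
    obtain ⟨ω, hω⟩ := hHne
    exact (tsub_pos_of_lt (lt_of_le_of_lt le_add_self (hn ω hω))).ne'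
  have hRt : R ≠ ∞ := ENNReal.sub_ne_top ENNReal.ofReal_ne_top
  set Y : Ω → ℝ≥0∞ := fun ω => ENNReal.ofReal (p.beta * p.gamma) * S.interference p t 0 j ω
  have hYm : Measurable Y := (Network.measurable_interference p h.measurable_pos
    (h.measurable_dest t) (h.measurable_isOn t) (h.measurable_fade t) 0 j).const_mul _
  -- Hypothesis `hn` places twice the conditional mean below `R`; Markov's inequality at level `R`
  -- then removes at most half of the mass of `H ∩ E`.
  have hYint : ∫⁻ ω in H ∩ E, Y ω ∂Pr ≤ R / 2 * Pr (H ∩ E) := by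
    rw [lintegral_const_mul' _ _ ENNReal.ofReal_ne_top,
      h.measure_inter_slotEvent hμ hM he0 he t _ b _ hA hH]
    refine (mul_le_mul_right hI _).trans ?_
    rw [← lintegral_const_mul' _ _ ENNReal.ofReal_ne_top,
      ← lintegral_const_mul' _ _ (ENNReal.div_ne_top hRt two_ne_zero)]
    refine setLIntegral_mono' (hle _ hH) fun ω hω => ?_
    rw [Finset.prod_singleton, ← mul_assoc]
    refine mul_le_mul_left ?_ _
    rw [ENNReal.le_div_iff_mul_le (Or.inl two_ne_zero) (Or.inl ENNReal.ofNat_ne_top), mul_comm, hR]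
    exact ENNReal.le_sub_of_add_le_right ENNReal.ofReal_ne_top (hn ω hω).le
  have hbad : Pr (H ∩ E ∩ {ω | R ≤ Y ω}) ≤ Pr (H ∩ E) / 2 := by
    have hmk := mul_meas_ge_le_lintegral (μ := Pr.restrict (H ∩ E)) hYm R
    rw [Measure.restrict_apply (measurableSet_le measurable_const hYm), Set.inter_comm] at hmk
    have h2 := hmk.trans hYint
    rw [ENNReal.mul_comm_div] at h2
    exact (ENNReal.mul_le_mul_iff_right hR0 hRt).mp h2
  refine ENNReal.half_le_of_le_half_add (measure_ne_top _ _) ?_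
  have hsub : H ∩ E ⊆ (H ∩ E ∩ {ω | R ≤ Y ω}) ∪ (H ∩ S.success p t) := by
    intro ω hω
    by_cases hY : R ≤ Y ω
    · exact Or.inl ⟨hω, hY⟩
    refine Or.inr ⟨hω.1, ?_⟩
    rw [not_le] at hY
    have hon0 : S.isOn t 0 ω = true := by
      rw [hω.2.1 0 (by simp)]; simp [b, hj.symm]
    have honj : S.isOn t j ω = false := by
      rw [hω.2.1 j (by simp)]; simp [b]
    have hh : (n : ℝ) < S.fade t 0 j ω := hω.2.2 (0, j) (by simp)
    have hl := hloss ω hω.1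
    -- The power is inversely proportional to the loss towards the receiver, so the received signal
    -- is `c` times the fading.
    have hpow : S.power p t 0 ω * S.fade t 0 j ω * S.loss p 0 j ω = p.c * S.fade t 0 j ω := by
      unfold Network.power
      rw [hnn ω hω.1]
      field_simp
    change ENNReal.ofReal p.beta < S.sinr p t 0 (S.nn t 0 ω) ω
    unfold Network.sinr
    rw [hnn ω hω.1, if_pos ⟨hon0, honj⟩, hpow]
    have hmain : ENNReal.ofReal p.beta * (ENNReal.ofReal p.gamma * S.interference p t 0 j ω +
        ENNReal.ofReal p.noise) < ENNReal.ofReal (p.c * S.fade t 0 j ω) := by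
      have h3 : Y ω + ENNReal.ofReal (p.beta * p.noise) < ENNReal.ofReal (p.c * n) :=
        lt_tsub_iff_right.mp hY
      rw [mul_add, ← mul_assoc, ← ENNReal.ofReal_mul hβ.le, ← ENNReal.ofReal_mul hβ.le]
      exact h3.trans_le (ENNReal.ofReal_le_ofReal (mul_le_mul_of_nonneg_left hh.le hc.le))
    refine (ENNReal.lt_div_iff_mul_lt (Or.inr ENNReal.ofReal_ne_top) (Or.inr ?_)).mpr hmain
    exact (ENNReal.ofReal_pos.mpr hβ).ne'
  calc Pr (H ∩ E) ≤ _ := measure_mono hsub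
    _ ≤ _ := measure_union_le _ _
    _ ≤ _ := by gcongr

end IsNetwork

/-! ### The inverse success probability in terms of the shot noise -/

/-- `EReal.exp` takes values in `ℝ≥0∞` and sends `∞` to `∞`, so an infinite shot noise can be
carried along without a case distinction. -/
theorem EReal.exp_coe_ennreal {s : ℝ≥0∞} (hs : s ≠ ∞) :
    EReal.exp (s : EReal) = ENNReal.ofReal (Real.exp s.toReal) := by
  rw [← EReal.coe_ennreal_toReal hs, EReal.exp_coe]

theorem EReal.one_le_exp_coe_ennreal (s : ℝ≥0∞) : 1 ≤ EReal.exp (s : EReal) :=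
  EReal.one_le_exp_iff.mpr (EReal.coe_ennreal_nonneg s)

theorem EReal.exp_coe_ennreal_lt_top_iff {s : ℝ≥0∞} : EReal.exp (s : EReal) < ∞ ↔ s < ∞ := by
  rw [EReal.exp_lt_top_iff, lt_top_iff_ne_top, lt_top_iff_ne_top, Ne, EReal.coe_ennreal_eq_top_iff]

namespace Network

variable {Ω : Type*} {m : ℕ} (S : Network Ω m) (p : SINRParams)

/-- An upper bound for the conditional mean, given the history, of the weighted interference at
node `j`. -/
noncomputable def meanInterference (j : ℕ) (ω : Ω) : ℝ≥0∞ :=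
  ENNReal.ofReal (p.beta * p.gamma) * (ENNReal.ofReal p.avgPower *
    (∑' z, ENNReal.ofReal (S.loss p z j ω)) * ∫⁻ s, ENNReal.ofReal s ∂(expMeasure p.mu))

theorem measurable_meanInterference [MeasurableSpace Ω] (hp : ∀ i, Measurable (S.pos i)) (j : ℕ) :
    Measurable (S.meanInterference p j) :=
  (((Measurable.tsum fun z => (measurable_loss p hp z j).ennreal_ofReal).const_mul
    _).mul_const _).const_mul _

/-- A bound, up to a constant factor, for the inverse of the conditional success probability of
node `0` in slot `t`. -/
noncomputable def invSuccessBound (t : ℕ) (ω : Ω) : ℝ≥0∞ :=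
  (ENNReal.ofReal (S.loss p 0 (S.nn t 0 ω) ω))⁻¹ *
    EReal.exp (ENNReal.ofReal (2 * p.mu / p.c) * S.meanInterference p (S.nn t 0 ω) ω : ℝ≥0∞)

/-- The threshold for the fading power of the signal of node `0` in slot `t`. -/
noncomputable def fadeLevel (t : ℕ) (ω : Ω) : ℕ :=
  ⌊(p.beta * p.noise + 2 * (S.meanInterference p (S.nn t 0 ω) ω).toReal) / p.c⌋₊ + 1

/-- The event that node `0` has a proper receiver with finite mean interference in slot `t`. -/
def regular (t : ℕ) : Set Ω :=
  {ω | S.nn t 0 ω ≠ 0 ∧ 0 < S.loss p 0 (S.nn t 0 ω) ω ∧ S.meanInterference p (S.nn t 0 ω) ω < ∞}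

theorem measurable_fadeLevel [MeasurableSpace Ω] {t : ℕ} (hp : ∀ i, Measurable (S.pos i))
    (hd : ∀ i, Measurable (S.dest t i)) : Measurable (S.fadeLevel p t) :=
  (Nat.measurable_floor.comp
    ((((measurable_of_countable_choice (S.measurable_meanInterference p hp)
      (measurable_nn hp hd 0)).ennreal_toReal.const_mul _).const_add _).div_const _)).add_const 1

theorem measurableSet_regular [MeasurableSpace Ω] {t : ℕ} (hp : ∀ i, Measurable (S.pos i))
    (hd : ∀ i, Measurable (S.dest t i)) : MeasurableSet (S.regular p t) :=
  (measurable_nn hp hd 0 (measurableSet_singleton 0).compl).inter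
    ((measurableSet_lt measurable_const
      (measurable_of_countable_choice (measurable_loss p hp 0) (measurable_nn hp hd 0))).inter
    (measurableSet_lt (measurable_of_countable_choice (S.measurable_meanInterference p hp)
      (measurable_nn hp hd 0)) measurable_const))

variable {p}

/-- Origin of the constant: node `0` is on with probability `(1 - ε)` times the loss, the receiver
is off with probability at least `ε`, Markov costs the factor `2`, and rounding up the fading level
costs at most `1` in the exponent. -/
theorem inv_invSuccessBound_le (hμ : 0 < p.mu) (hM : 0 < p.avgPower) (he0 : 0 < p.eps)
    (he : p.eps < 1) (hβ : 0 < p.beta) (hN : 0 ≤ p.noise) (t : ℕ) {ω : Ω}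
    (hω : ω ∈ S.regular p t) :
    (ENNReal.ofReal (2 / ((1 - p.eps) * p.eps) * Real.exp (p.mu * (p.beta * p.noise / p.c + 1))) *
      S.invSuccessBound p t ω)⁻¹ ≤
    ENNReal.ofReal (S.txProb p t 0 ω * (1 - S.txProb p t (S.nn t 0 ω) ω)) *
        ENNReal.ofReal (Real.exp (-(p.mu * S.fadeLevel p t ω))) / 2 := by
  obtain ⟨hn0, hl, hfin⟩ := hω
  have hc : 0 < p.c := mul_pos hM (inv_pos.mpr (sub_pos.mpr he))
  have he1 : 0 < 1 - p.eps := sub_pos.mpr he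
  set r := (S.meanInterference p (S.nn t 0 ω) ω).toReal with hr
  set l := S.loss p 0 (S.nn t 0 ω) ω with hldef
  have hr0 : 0 ≤ r := ENNReal.toReal_nonneg
  have hB : S.invSuccessBound p t ω = ENNReal.ofReal (l⁻¹ * Real.exp (2 * p.mu / p.c * r)) := by
    unfold invSuccessBound
    rw [EReal.exp_coe_ennreal (ENNReal.mul_lt_top ENNReal.ofReal_lt_top hfin).ne,
      ENNReal.toReal_mul, ENNReal.toReal_ofReal (by positivity), ← ENNReal.ofReal_inv_of_pos hl,
      ← ENNReal.ofReal_mul (inv_pos.mpr hl).le]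
  have hpj := S.txProb_le t hM he (S.nn t 0 ω) ω
  have hp0 : S.txProb p t 0 ω = (1 - p.eps) * l := S.txProb_eq t hM 0 ω
  rw [hB, ← ENNReal.ofReal_mul (by positivity), ← ENNReal.ofReal_inv_of_pos (by positivity),
    ← ENNReal.ofReal_mul (mul_nonneg (S.txProb_nonneg t hM he _ _) (by linarith)),
    ← ENNReal.ofReal_ofNat 2, ← ENNReal.ofReal_div_of_pos two_pos]
  refine ENNReal.ofReal_le_ofReal ?_
  have hlev : (S.fadeLevel p t ω : ℝ) ≤ (p.beta * p.noise + 2 * r) / p.c + 1 := by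
    unfold fadeLevel
    push_cast
    gcongr
    exact Nat.floor_le (by positivity)
  have hexp : Real.exp (-(p.mu * (p.beta * p.noise / p.c + 1))) * Real.exp (-(2 * p.mu / p.c * r)) ≤
      Real.exp (-(p.mu * S.fadeLevel p t ω)) := by
    rw [← Real.exp_add, Real.exp_le_exp]
    have : p.mu * S.fadeLevel p t ω ≤ p.mu * ((p.beta * p.noise + 2 * r) / p.c + 1) := by gcongr
    have e : p.mu * ((p.beta * p.noise + 2 * r) / p.c + 1) =
        p.mu * (p.beta * p.noise / p.c + 1) + 2 * p.mu / p.c * r := by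
      field_simp
      ring
    linarith
  have hE1 : (2 / ((1 - p.eps) * p.eps) * Real.exp (p.mu * (p.beta * p.noise / p.c + 1)) *
      (l⁻¹ * Real.exp (2 * p.mu / p.c * r)))⁻¹ =
      ((1 - p.eps) * l * p.eps) * (Real.exp (-(p.mu * (p.beta * p.noise / p.c + 1))) *
        Real.exp (-(2 * p.mu / p.c * r))) / 2 := by
    rw [Real.exp_neg, Real.exp_neg]
    field_simp
  have hp1 : 0 ≤ 1 - S.txProb p t (S.nn t 0 ω) ω := by linarith
  rw [hE1, hp0]
  gcongr
  linarith

end Network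

/-! ### From conditional success probabilities to the mean exit time -/

namespace IsNetwork

variable {Ω : Type*} [mΩ : MeasurableSpace Ω] {m : ℕ} {S : Network Ω m} {p : SINRParams}
  {Pr : Measure Ω} {Q : Measure PointConfig} {x : Plane} [IsProbabilityMeasure Pr]

/-- The one-slot bound is for a fixed receiver and a fixed fading level. Both are functions of the
history with countably many values, so `H` is cut along them and the bounds are added. -/
theorem lintegral_inv_le_measure_success (h : IsNetwork S p Pr Q x) (hμ : 0 < p.mu)
    (hM : 0 < p.avgPower) (he0 : 0 < p.eps) (he : p.eps < 1) (hβ : 0 < p.beta)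
    (hN : 0 ≤ p.noise) (t : ℕ) {V : Ω → ℝ≥0∞}
    (hreg : ∀ᵐ ω ∂Pr, ω ∈ S.regular p t ∧ ENNReal.ofReal (2 / ((1 - p.eps) * p.eps) *
      Real.exp (p.mu * (p.beta * p.noise / p.c + 1))) * S.invSuccessBound p t ω ≤ V ω)
    {H : Set Ω} (hH : MeasurableSet[S.history t] H) :
    ∫⁻ ω in H, (V ω)⁻¹ ∂Pr ≤ Pr (H ∩ S.success p t) := by
  have hle := h.history_le t
  have hc : 0 < p.c := mul_pos hM (inv_pos.mpr (sub_pos.mpr he))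
  have hposH := S.measurable_pos_history t
  have hdestH := S.measurable_dest_history (le_refl t)
  set K : ℕ × ℕ → Set Ω := fun q =>
    H ∩ (S.regular p t ∩ (S.nn t 0 ⁻¹' {q.1} ∩ S.fadeLevel p t ⁻¹' {q.2})) with hK
  have hKm : ∀ q, MeasurableSet[S.history t] (K q) := by
    intro q
    refine @MeasurableSet.inter _ (S.history t) _ _ hH
      (@MeasurableSet.inter _ (S.history t) _ _
        (@Network.measurableSet_regular Ω m S p (S.history t) t hposH hdestH)
        (@MeasurableSet.inter _ (S.history t) _ _ ?_ ?_))
    · exact @Network.measurable_nn Ω m S t (S.history t) hposH hdestH 0 _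
        (measurableSet_singleton _)
    · exact @Network.measurable_fadeLevel Ω m S p (S.history t) t hposH hdestH _
        (measurableSet_singleton _)
  have hdisj : Pairwise (Function.onFun Disjoint K) := by
    intro q q' hqq
    refine Set.disjoint_left.mpr fun ω hω hω' => hqq ?_
    exact Prod.ext (hω.2.2.1.symm.trans hω'.2.2.1) (hω.2.2.2.symm.trans hω'.2.2.2)
  have hKH : ⋃ q, K q = H ∩ S.regular p t := by
    ext ω
    simp only [Set.mem_iUnion]
    constructor
    · rintro ⟨q, hq⟩
      exact ⟨hq.1, hq.2.1⟩
    · rintro ⟨h1, h2⟩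
      exact ⟨(S.nn t 0 ω, S.fadeLevel p t ω), h1, h2, rfl, rfl⟩
  have hKbound : ∀ q, ∫⁻ ω in K q, (V ω)⁻¹ ∂Pr ≤ Pr (K q ∩ S.success p t) := by
    rintro ⟨j, n⟩
    rcases (K (j, n)).eq_empty_or_nonempty with he' | ⟨ω₀, hω₀⟩
    · simp [he']
    have hj : j ≠ 0 := by
      have h1 : S.nn t 0 ω₀ = j := hω₀.2.2.1
      exact h1 ▸ hω₀.2.1.1
    have hnn : ∀ ω ∈ K (j, n), S.nn t 0 ω = j := fun ω hω => hω.2.2.1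
    have hlev : ∀ ω ∈ K (j, n), S.fadeLevel p t ω = n := fun ω hω => hω.2.2.2
    refine le_trans ?_ (h.half_lintegral_le_measure_success hμ hM he0 he hβ t n hj (hKm (j, n))
      hnn (fun ω hω => hnn ω hω ▸ hω.2.1.2.1) fun ω hω => ?_)
    · rw [div_eq_mul_inv, ← lintegral_mul_const' _ _ (by simp)]
      refine lintegral_mono_ae ?_
      filter_upwards [ae_restrict_of_ae hreg, ae_restrict_mem (hle _ (hKm (j, n)))] with ω hω hωK
      refine (ENNReal.inv_le_inv.mpr hω.2).trans ?_
      refine (S.inv_invSuccessBound_le hμ hM he0 he hβ hN t hω.1).trans_eq ?_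
      rw [hnn ω hωK, hlev ω hωK, div_eq_mul_inv]
    · have hfin := hω.2.1.2.2
      have hl := hlev ω hω
      unfold Network.fadeLevel at hl
      rw [hnn ω hω] at hfin hl
      have hfl := Nat.lt_floor_add_one
        ((p.beta * p.noise + 2 * (S.meanInterference p j ω).toReal) / p.c)
      change 2 * S.meanInterference p j ω + _ < _
      rw [← ENNReal.ofReal_toReal hfin.ne, ← ENNReal.ofReal_ofNat 2,
        ← ENNReal.ofReal_mul two_pos.le, ← ENNReal.ofReal_add (by positivity) (by positivity),
        ENNReal.ofReal_lt_ofReal_iff_of_nonneg (by positivity), ← hl]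
      rw [div_lt_iff₀ hc] at hfl
      push_cast
      linarith
  calc ∫⁻ ω in H, (V ω)⁻¹ ∂Pr = ∫⁻ ω in H ∩ S.regular p t, (V ω)⁻¹ ∂Pr := by
        refine setLIntegral_congr ?_
        filter_upwards [hreg] with ω hω
        exact propext ⟨fun hh => ⟨hh, hω.1⟩, fun hh => hh.1⟩
    _ = ∑' q, ∫⁻ ω in K q, (V ω)⁻¹ ∂Pr := by
        rw [← hKH, lintegral_iUnion (fun q => hle _ (hKm q)) hdisj]
    _ ≤ ∑' q, Pr (K q ∩ S.success p t) := ENNReal.tsum_le_tsum hKbound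
    _ = Pr (⋃ q, K q ∩ S.success p t) := by
        refine (measure_iUnion (fun q q' hqq => ?_) fun q => ?_).symm
        · exact (hdisj hqq).mono Set.inter_subset_left Set.inter_subset_left
        · exact (hle _ (hKm q)).inter (Network.measurableSet_success p h.measurable_pos
            (h.measurable_dest t) (h.measurable_isOn t) (h.measurable_fade t))
    _ ≤ _ := by
        refine measure_mono (Set.iUnion_subset fun q => ?_)
        exact Set.inter_subset_inter_left _ Set.inter_subset_left

/-- The lower bound `V⁻¹` is an inequality between measures on the history σ-algebra. Testing it
against `V` on `H` cancels `V⁻¹`, because `V` is history-measurable and almost surely neither `0`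
nor `∞`. -/
theorem measure_le_setLIntegral_success (h : IsNetwork S p Pr Q x) (hμ : 0 < p.mu)
    (hM : 0 < p.avgPower) (he0 : 0 < p.eps) (he : p.eps < 1) (hβ : 0 < p.beta)
    (hN : 0 ≤ p.noise) (t : ℕ) {V : Ω → ℝ≥0∞} (hV : Measurable[S.history t] V)
    (hV0 : ∀ᵐ ω ∂Pr, V ω ≠ 0) (hVt : ∀ᵐ ω ∂Pr, V ω ≠ ∞)
    (hreg : ∀ᵐ ω ∂Pr, ω ∈ S.regular p t ∧ ENNReal.ofReal (2 / ((1 - p.eps) * p.eps) *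
      Real.exp (p.mu * (p.beta * p.noise / p.c + 1))) * S.invSuccessBound p t ω ≤ V ω)
    {H : Set Ω} (hH : MeasurableSet[S.history t] H) :
    Pr H ≤ ∫⁻ ω in H ∩ S.success p t, V ω ∂Pr := by
  have hle := h.history_le t
  have hVm := hV.mono hle le_rfl
  have hG : MeasurableSet (S.success p t) := Network.measurableSet_success p h.measurable_pos
    (h.measurable_dest t) (h.measurable_isOn t) (h.measurable_fade t)
  have hm : (Pr.withDensity fun ω => (V ω)⁻¹).trim hle ≤ (Pr.restrict (S.success p t)).trim hle := by
    refine Measure.le_iff.mpr fun s hs => ?_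
    rw [trim_measurableSet_eq hle hs, trim_measurableSet_eq hle hs,
      Measure.restrict_apply (hle _ hs), withDensity_apply _ (hle _ hs)]
    exact h.lintegral_inv_le_measure_success hμ hM he0 he hβ hN t hreg hs
  have hind : Measurable[S.history t] (H.indicator V) := hV.indicator hH
  have h1 : ∫⁻ ω, H.indicator V ω ∂(Pr.withDensity fun ω => (V ω)⁻¹) ≤
      ∫⁻ ω, H.indicator V ω ∂(Pr.restrict (S.success p t)) := by
    rw [← lintegral_trim hle hind, ← lintegral_trim hle hind]
    exact lintegral_mono' hm le_rfl
  rw [lintegral_withDensity_eq_lintegral_mul _ (f := fun ω => (V ω)⁻¹) hVm.inv (hind.mono hle le_rfl),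
    lintegral_indicator (hle _ hH), Measure.restrict_restrict (hle _ hH)] at h1
  refine le_trans (le_of_eq ?_) h1
  rw [← lintegral_indicator_one (hle _ hH)]
  refine lintegral_congr_ae ?_
  filter_upwards [hV0, hVt] with ω h0 ht
  by_cases hω : ω ∈ H
  · simp [hω, ENNReal.inv_mul_cancel h0 ht]
  · simp [hω]

/-- The exit time is dominated by the number of `n` for which slots `1, …, n` all fail. Each such
probability is charged to the event of a first success in slot `n + 1`; since `V` is the same in all
slots, these disjoint charges add up to at most its mean. -/
theorem lintegral_exitTime_le (h : IsNetwork S p Pr Q x) (hμ : 0 < p.mu)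
    (hM : 0 < p.avgPower) (he0 : 0 < p.eps) (he : p.eps < 1) (hβ : 0 < p.beta)
    (hN : 0 ≤ p.noise) {V : Ω → ℝ≥0∞} (hV : ∀ t, Measurable[S.history t] V)
    (hV0 : ∀ᵐ ω ∂Pr, V ω ≠ 0) (hVt : ∀ᵐ ω ∂Pr, V ω ≠ ∞)
    (hreg : ∀ t, ∀ᵐ ω ∂Pr, ω ∈ S.regular p t ∧ ENNReal.ofReal (2 / ((1 - p.eps) * p.eps) *
      Real.exp (p.mu * (p.beta * p.noise / p.c + 1))) * S.invSuccessBound p t ω ≤ V ω) :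
    ∫⁻ ω, S.exitTime p 0 ω ∂Pr ≤ ∫⁻ ω, V ω ∂Pr := by
  classical
  set G : ℕ → Set Ω := S.success p
  have hG : ∀ t, MeasurableSet (G t) := fun t => Network.measurableSet_success p h.measurable_pos
    (h.measurable_dest t) (h.measurable_isOn t) (h.measurable_fade t)
  -- Slots are counted from `1`, so `F 0` is the whole space, and `F n` belongs to the history of
  -- slot `n + 1`.
  set F : ℕ → Set Ω := fun n => ⋂ s ∈ Finset.Icc 1 n, (G s)ᶜ with hF
  have hFH : ∀ n, MeasurableSet[S.history (n + 1)] (F n) := by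
    intro n
    refine @Finset.measurableSet_biInter _ _ (S.history (n + 1)) _ _ fun s hs => ?_
    exact @MeasurableSet.compl _ _ (S.history (n + 1)) (S.measurableSet_success_history p
      (Nat.lt_succ_of_le (Finset.mem_Icc.mp hs).2))
  have hFm : ∀ n, MeasurableSet (F n) := fun n => h.history_le _ _ (hFH n)
  have hT : ∀ ω, S.exitTime p 0 ω ≤ ∑' n, (F n).indicator 1 ω := by
    intro ω
    by_cases hex : ∃ t, 0 < t ∧ ω ∈ G t
    · have hspec := Nat.find_spec hex
      calc S.exitTime p 0 ω ≤ (Nat.find hex : ℝ≥0∞) :=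
            iInf₂_le (f := fun (t : ℕ) (_ : 0 < t ∧ ω ∈ G t) => (t : ℝ≥0∞)) _ hspec
        _ = ∑ n ∈ Finset.range (Nat.find hex), (F n).indicator 1 ω := by
            rw [Finset.sum_congr rfl (g := fun _ => (1 : ℝ≥0∞)), Finset.sum_const,
              Finset.card_range, nsmul_eq_mul, mul_one]
            intro n hn
            refine Set.indicator_of_mem (Set.mem_iInter₂.mpr fun s hs hsG => ?_) _
            have := Finset.mem_Icc.mp hs
            exact Nat.find_min hex (this.2.trans_lt (Finset.mem_range.mp hn)) ⟨this.1, hsG⟩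
        _ ≤ _ := ENNReal.sum_le_tsum _
    · push Not at hex
      have : ∀ n, (F n).indicator (1 : Ω → ℝ≥0∞) ω = 1 := fun n =>
        Set.indicator_of_mem (Set.mem_iInter₂.mpr fun s hs => hex s (Finset.mem_Icc.mp hs).1) _
      simp [this]
  have hdisj : Pairwise (Function.onFun Disjoint fun n => F n ∩ G (n + 1)) := by
    have key : ∀ a b, a < b → Disjoint (F a ∩ G (a + 1)) (F b ∩ G (b + 1)) := fun a b hab =>
      Set.disjoint_left.mpr fun ω hω hω' => Set.mem_iInter₂.mp hω'.1 (a + 1)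
        (Finset.mem_Icc.mpr ⟨by omega, by omega⟩) hω.2
    intro a b hab
    rcases lt_or_gt_of_ne hab with hlt | hlt
    · exact key a b hlt
    · exact (key b a hlt).symm
  calc ∫⁻ ω, S.exitTime p 0 ω ∂Pr ≤ ∫⁻ ω, ∑' n, (F n).indicator 1 ω ∂Pr := lintegral_mono hT
    _ = ∑' n, ∫⁻ ω, (F n).indicator 1 ω ∂Pr :=
        lintegral_tsum fun n => (measurable_one.indicator (hFm n)).aemeasurable
    _ = ∑' n, Pr (F n) := by simp only [lintegral_indicator_one (hFm _)]
    _ ≤ ∑' n, ∫⁻ ω in F n ∩ G (n + 1), V ω ∂Pr := ENNReal.tsum_le_tsum fun n =>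
        h.measure_le_setLIntegral_success hμ hM he0 he hβ hN (n + 1) (hV _) hV0 hVt
          (hreg _) (hFH n)
    _ = ∫⁻ ω in ⋃ n, F n ∩ G (n + 1), V ω ∂Pr :=
        (lintegral_iUnion (fun n => (hFm n).inter (hG _)) hdisj _).symm
    _ ≤ ∫⁻ ω, V ω ∂Pr := setLIntegral_le_lintegral _ _

end IsNetwork

/-! ### Geometry of the cones and of the integer lattice -/

/-- The axis of the `k`-th cone. -/
noncomputable def coneAxis (m : ℕ) (k : Fin m) : Plane :=
  !₂[Real.cos (2 * (k : ℝ) * (Real.pi / m)), Real.sin (2 * (k : ℝ) * (Real.pi / m))]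

theorem norm_plane_sq (v : Plane) : ‖v‖ ^ 2 = v 0 ^ 2 + v 1 ^ 2 := by
  rw [EuclideanSpace.norm_sq_eq]
  simp

theorem norm_coneAxis (m : ℕ) (k : Fin m) : ‖coneAxis m k‖ = 1 := by
  have h := norm_plane_sq (coneAxis m k)
  simp only [coneAxis, PiLp.toLp_apply, Matrix.cons_val_zero, Matrix.cons_val_one,
    Real.cos_sq_add_sin_sq] at h
  exact (pow_eq_one_iff_of_nonneg (norm_nonneg _) two_ne_zero).mp h

theorem zero_notMem_cone (m : ℕ) (k : Fin m) : (0 : Plane) ∉ cone m k := by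
  rintro ⟨r, θ, hr, -, -, h⟩
  have h0 : r * Real.cos θ = 0 := by
    have := congrArg (fun v : Plane => v 0) h
    simpa using this.symm
  have h1 : r * Real.sin θ = 0 := by
    have := congrArg (fun v : Plane => v 1) h
    simpa using this.symm
  nlinarith [Real.cos_sq_add_sin_sq θ, mul_pos hr hr]

/-- The ball is tangent to the two sides of the cone. After rotating the axis to the positive real
line, lying on the inner side of both bounding lines reads `sin (δ ± θ) > 0`, which forces `|θ| <
δ`. For `s ≤ 0` the ball is empty. -/
theorem ball_subset_cone {m : ℕ} (k : Fin m) (hm : Real.pi / m < Real.pi / 2) (s : ℝ) :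
    Metric.ball (s • coneAxis m k) (s * Real.sin (Real.pi / m)) ⊆ cone m k := by
  intro v hv
  have hm0 : 0 < m := k.pos
  set δ := Real.pi / m with hδ
  have hδ0 : 0 < δ := div_pos Real.pi_pos (Nat.cast_pos.mpr hm0)
  have hsin : 0 < Real.sin δ := Real.sin_pos_of_pos_of_lt_pi hδ0 (by linarith [Real.pi_pos])
  set η := 2 * (k : ℝ) * δ with hη
  rw [Metric.mem_ball, dist_eq_norm] at hv
  have hr0 : 0 < s * Real.sin δ := (norm_nonneg _).trans_lt hv
  have hsq : (v 0 - s * Real.cos η) ^ 2 + (v 1 - s * Real.sin η) ^ 2 < (s * Real.sin δ) ^ 2 := by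
    have h1 := norm_plane_sq (v - s • coneAxis m k)
    simp only [coneAxis, PiLp.sub_apply, PiLp.smul_apply, smul_eq_mul,
      Matrix.cons_val_zero, Matrix.cons_val_one] at h1
    rw [← h1]
    exact pow_lt_pow_left₀ hv (norm_nonneg _) two_ne_zero
  set w : ℂ := ⟨v 0 * Real.cos η + v 1 * Real.sin η, v 1 * Real.cos η - v 0 * Real.sin η⟩ with hw
  have hcs := Real.cos_sq_add_sin_sq η
  have hcd := Real.cos_sq_add_sin_sq δ
  have hsq' : (w.re - s) ^ 2 + w.im ^ 2 < (s * Real.sin δ) ^ 2 := by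
    refine lt_of_eq_of_lt ?_ hsq
    simp only [hw]
    linear_combination (v 0 ^ 2 + v 1 ^ 2 - s ^ 2) * hcs
  -- The signs `e = 1` and `e = -1` give the two sides; the inequality is Cauchy–Schwarz against the
  -- unit normal `(sin δ, e cos δ)`.
  have hpm : ∀ e : ℝ, e ^ 2 = 1 → 0 < w.re * Real.sin δ + e * w.im * Real.cos δ := by
    intro e he
    have h1 : ((w.re - s) * Real.sin δ + e * w.im * Real.cos δ) ^ 2 < (s * Real.sin δ) ^ 2 := by
      refine lt_of_le_of_lt ?_ hsq'
      have : (w.re - s) ^ 2 + w.im ^ 2 - ((w.re - s) * Real.sin δ + e * w.im * Real.cos δ) ^ 2 =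
          ((w.re - s) * Real.cos δ - e * w.im * Real.sin δ) ^ 2 := by
        linear_combination (-(w.re - s) ^ 2 - e ^ 2 * w.im ^ 2) * hcd - w.im ^ 2 * he
      nlinarith [sq_nonneg ((w.re - s) * Real.cos δ - e * w.im * Real.sin δ)]
    have h2 := (abs_lt_of_sq_lt_sq h1 hr0.le)
    have h3 := (abs_lt.mp h2).1
    linarith
  have hp1 := hpm 1 (by norm_num)
  have hp2 := hpm (-1) (by norm_num)
  set r := ‖w‖ with hr
  set θ := w.arg with hθ
  have hre : r * Real.cos θ = w.re := Complex.norm_mul_cos_arg w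
  have him : r * Real.sin θ = w.im := Complex.norm_mul_sin_arg w
  have hw0 : w ≠ 0 := by
    intro h0
    rw [h0] at hp1
    simp at hp1
  have hrpos : 0 < r := norm_pos_iff.mpr hw0
  have hwre : 0 < w.re := by
    have : 0 < w.re * Real.sin δ := by linarith
    exact (pos_iff_pos_of_mul_pos this).mpr hsin
  have hθabs : |θ| < Real.pi / 2 := Complex.abs_arg_lt_pi_div_two_iff.mpr (Or.inl hwre)
  obtain ⟨hθ1, hθ2⟩ := abs_lt.mp hθabs
  have hplus : 0 < Real.sin (δ + θ) := by
    rw [Real.sin_add]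
    rw [← hre, ← him] at hp1
    refine (pos_iff_pos_of_mul_pos (a := r) ?_).mp hrpos
    linarith
  have hminus : 0 < Real.sin (δ - θ) := by
    rw [Real.sin_sub]
    rw [← hre, ← him] at hp2
    refine (pos_iff_pos_of_mul_pos (a := r) ?_).mp hrpos
    linarith
  have hlo : -δ < θ := by
    by_contra! hcon
    have := Real.sin_nonpos_of_nonpos_of_neg_pi_le (x := δ + θ) (by linarith) (by linarith)
    linarith
  have hhi : θ < δ := by
    by_contra! hcon
    have := Real.sin_nonpos_of_nonpos_of_neg_pi_le (x := δ - θ) (by linarith) (by linarith)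
    linarith
  refine ⟨r, η + θ, hrpos, by rw [hη]; linarith, by rw [hη]; linarith, ?_⟩
  ext i
  fin_cases i
  · simp only [Fin.zero_eta, Matrix.cons_val_zero, Real.cos_add]
    have : r * (Real.cos η * Real.cos θ - Real.sin η * Real.sin θ) =
      Real.cos η * w.re - Real.sin η * w.im := by rw [← hre, ← him]; ring
    rw [this]
    simp only [hw]
    linear_combination (-(v 0)) * hcs
  · simp only [Fin.mk_one, Matrix.cons_val_one, Real.sin_add]
    have : r * (Real.sin η * Real.cos θ + Real.cos η * Real.sin θ) =
      Real.sin η * w.re + Real.cos η * w.im := by rw [← hre, ← him]; ring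
    simp only [Matrix.cons_val_fin_one]
    rw [this]
    simp only [hw]
    linear_combination (-(v 1)) * hcs

theorem norm_lt_of_mem_ball_coneAxis {m : ℕ} {k : Fin m} {s : ℝ} {v : Plane}
    (hs : 0 ≤ s) (hv : v ∈ Metric.ball (s • coneAxis m k) (s * Real.sin (Real.pi / m))) :
    ‖v‖ < 2 * s := by
  rw [Metric.mem_ball, dist_eq_norm] at hv
  have h1 : ‖s • coneAxis m k‖ = s := by
    rw [norm_smul, norm_coneAxis, mul_one, Real.norm_of_nonneg hs]
  have h2 := norm_le_norm_add_norm_sub' v (s • coneAxis m k)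
  have h3 : s * Real.sin (Real.pi / m) ≤ s := mul_le_of_le_one_right hs (Real.sin_le_one _)
  linarith

/-- The integer lattice cell of a point of the plane. -/
noncomputable def latticeCell (v : Plane) : Fin 2 → ℤ := fun i => ⌊v i⌋

theorem norm_latticeCell_sub_le (v w : Plane) :
    ‖latticeCell v - latticeCell w‖ ≤ ‖v - w‖ + 1 := by
  refine (pi_norm_le_iff_of_nonneg (by positivity)).mpr fun i => ?_
  have h1 : |v i - w i| ≤ ‖v - w‖ := by
    have := PiLp.norm_apply_le (v - w) i
    simpa using this
  have := Int.floor_le (v i)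
  have := Int.lt_floor_add_one (v i)
  have := Int.floor_le (w i)
  have := Int.lt_floor_add_one (w i)
  obtain ⟨h2, h3⟩ := abs_le.mp h1
  rw [Int.norm_eq_abs]
  simp only [latticeCell, Pi.sub_apply, Int.cast_sub]
  rw [abs_le]
  constructor <;> linarith

theorem latticeCell_zero : latticeCell 0 = 0 := by
  ext i
  simp [latticeCell]

theorem norm_latticeCell_le (v : Plane) : ‖latticeCell v‖ ≤ ‖v‖ + 1 := by
  simpa [latticeCell_zero] using norm_latticeCell_sub_le v 0

theorem norm_le_two_mul_norm_latticeCell (v : Plane) : ‖v‖ ≤ 2 * (‖latticeCell v‖ + 1) := by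
  have hi : ∀ i, |v i| ≤ ‖latticeCell v‖ + 1 := by
    intro i
    have h1 := norm_le_pi_norm (latticeCell v) i
    rw [Int.norm_eq_abs] at h1
    simp only [latticeCell] at h1 ⊢
    obtain ⟨h2, h3⟩ := abs_le.mp h1
    have := Int.floor_le (v i)
    have := Int.lt_floor_add_one (v i)
    rw [abs_le]
    constructor <;> linarith
  have h2 := norm_plane_sq v
  have h0 := sq_le_sq' (abs_le.mp (hi 0)).1 (abs_le.mp (hi 0)).2
  have h1 := sq_le_sq' (abs_le.mp (hi 1)).1 (abs_le.mp (hi 1)).2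
  refine abs_le_of_sq_le_sq' (a := ‖v‖) ?_ (by positivity) |>.2
  nlinarith [norm_nonneg (latticeCell v)]

/-- Power decay on the integer lattice. -/
noncomputable def latticeDecay (α : ℝ) (i : Fin 2 → ℤ) : ℝ := (1 + ‖i‖) ^ (-α)

theorem latticeDecay_nonneg (α : ℝ) (i : Fin 2 → ℤ) : 0 ≤ latticeDecay α i := by
  unfold latticeDecay
  positivity

theorem latticeDecay_le_one {α : ℝ} (hα : 0 ≤ α) (i : Fin 2 → ℤ) : latticeDecay α i ≤ 1 :=
  Real.rpow_le_one_of_one_le_of_nonpos (by linarith [norm_nonneg i]) (by linarith)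

theorem rpow_neg_le_mul_of_le {α a b c : ℝ} (hα : 0 ≤ α) (ha : 0 < a) (hb : 0 < b) (hc : 0 < c)
    (h : b ≤ c * a) : a ^ (-α) ≤ c ^ α * b ^ (-α) := by
  have h1 : a ^ (-α) = c ^ α * (c * a) ^ (-α) := by
    rw [Real.mul_rpow hc.le ha.le, ← mul_assoc, ← Real.rpow_add hc, add_neg_cancel,
      Real.rpow_zero, one_mul]
  rw [h1]
  exact mul_le_mul_of_nonneg_left (Real.rpow_le_rpow_of_nonpos hb h (by linarith)) (by positivity)

theorem pathLoss_le_latticeDecay {α : ℝ} (hα : 0 < α) (v w : Plane) :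
    pathLoss α (dist v w) ≤ 4 ^ α * latticeDecay α (latticeCell v - latticeCell w) := by
  set r := dist v w with hr
  have hle : ‖latticeCell v - latticeCell w‖ ≤ r + 1 := by
    rw [hr, dist_eq_norm]
    exact norm_latticeCell_sub_le v w
  have hn := norm_nonneg (latticeCell v - latticeCell w)
  have hr0 : 0 ≤ r := dist_nonneg
  rcases hr0.eq_or_lt with h0 | hpos
  -- At distance `0` the convention `0 ^ (-α) = 0` makes the path loss vanish; this covers the term
  -- of the receiver itself in the shot noise.
  · have : pathLoss α r = 0 := by
      unfold pathLoss
      rw [← h0, Real.zero_rpow (by linarith), min_eq_left zero_le_one]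
    rw [this]
    exact mul_nonneg (by positivity) (latticeDecay_nonneg _ _)
  rcases le_total 1 r with h1 | h1
  · refine (min_le_left _ _).trans ?_
    exact rpow_neg_le_mul_of_le hα.le hpos (by positivity) (by norm_num) (by linarith)
  · refine (min_le_right _ _).trans ?_
    have := rpow_neg_le_mul_of_le (a := 1) (b := 1 + ‖latticeCell v - latticeCell w‖) (c := 4)
      hα.le one_pos (by positivity) (by norm_num) (by linarith)
    rwa [Real.one_rpow] at this

theorem latticeDecay_le_of_norm_sub_le {α : ℝ} (hα : 0 ≤ α) {i j : Fin 2 → ℤ} (h : ‖i - j‖ ≤ 1) :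
    latticeDecay α i ≤ 2 ^ α * latticeDecay α j := by
  refine rpow_neg_le_mul_of_le hα (by positivity) (by positivity) two_pos ?_
  have h1 := norm_le_norm_add_norm_sub i j
  linarith [norm_nonneg i]

theorem inv_pathLoss_le {α : ℝ} (hα : 0 ≤ α) {v : Plane} (hv : v ≠ 0) :
    (pathLoss α ‖v‖)⁻¹ ≤ (2 * (‖latticeCell v‖ + 1)) ^ α := by
  have hv' : 0 < ‖v‖ := norm_pos_iff.mpr hv
  have hn := norm_nonneg (latticeCell v)
  refine inv_le_of_inv_le₀ (by positivity) ?_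
  rw [← Real.rpow_neg (by positivity)]
  refine le_min ?_ (Real.rpow_le_one_of_one_le_of_nonpos (by linarith) (by linarith))
  exact Real.rpow_le_rpow_of_nonpos hv' (norm_le_two_mul_norm_latticeCell v) (by linarith)

/-! ### A bound by a function of the node positions alone -/

/-- A sum over cones and lattice cells, of void indicators weighted by path loss and by an
exponential of the shot noise at the lattice cell. -/
noncomputable def voidSum (m : ℕ) (α : ℝ) (A : ℝ≥0∞) {ι : Type*} (f : ι → Plane) : ℝ≥0∞ :=
  open Classical in
  ∑' (k : Fin m) (j : Fin 2 → ℤ),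
    if ∀ i, f i ∉ Metric.ball (((‖j‖ - 1) / 2) • coneAxis m k)
        ((‖j‖ - 1) / 2 * Real.sin (Real.pi / m)) then
      ENNReal.ofReal ((2 * (‖j‖ + 1)) ^ α) *
        EReal.exp (A * ∑' i, ENNReal.ofReal (latticeDecay α (latticeCell (f i) - j)) : ℝ≥0∞)
    else 0

theorem voidSum_comp_equiv (m : ℕ) (α : ℝ) (A : ℝ≥0∞) {ι κ : Type*} (e : ι ≃ κ) (f : κ → Plane) :
    voidSum m α A (fun i => f (e i)) = voidSum m α A f := by
  unfold voidSum
  refine tsum_congr fun k => tsum_congr fun j => ?_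
  rw [e.tsum_eq (fun i => ENNReal.ofReal (latticeDecay α (latticeCell (f i) - j)))]
  by_cases h : ∀ i, f i ∉ Metric.ball (((‖j‖ - 1) / 2) • coneAxis m k)
      ((‖j‖ - 1) / 2 * Real.sin (Real.pi / m))
  · rw [if_pos h, if_pos fun i => h (e i)]
  · rw [if_neg h, if_neg fun h' => h fun i => by simpa using h' (e.symm i)]

theorem le_voidSum {m : ℕ} {α : ℝ} {A : ℝ≥0∞} {ι : Type*} {f : ι → Plane} (k : Fin m)
    (j : Fin 2 → ℤ) (h : ∀ i, f i ∉ Metric.ball (((‖j‖ - 1) / 2) • coneAxis m k)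
        ((‖j‖ - 1) / 2 * Real.sin (Real.pi / m))) :
    ENNReal.ofReal ((2 * (‖j‖ + 1)) ^ α) *
        EReal.exp (A * ∑' i, ENNReal.ofReal (latticeDecay α (latticeCell (f i) - j)) : ℝ≥0∞) ≤
      voidSum m α A f := by
  classical
  unfold voidSum
  refine le_trans ?_ (ENNReal.le_tsum k)
  refine le_trans ?_ (ENNReal.le_tsum j)
  rw [if_pos h]

/-- If a cone is empty then so are all the balls inside it, and each of the infinitely many lattice
cells contributes at least `1`. Thus finiteness of the void sum already guarantees a receiver in
every cone. -/
theorem voidSum_eq_top {m : ℕ} {α : ℝ} (hα : 0 ≤ α) {A : ℝ≥0∞} {ι : Type*} {f : ι → Plane}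
    (k : Fin m) (hm : Real.pi / m < Real.pi / 2) (h : ∀ i, f i ∉ cone m k) :
    voidSum m α A f = ∞ := by
  classical
  unfold voidSum
  refine top_le_iff.mp (le_trans ?_ (ENNReal.le_tsum k))
  rw [← ENNReal.tsum_const_eq_top_of_ne_zero (α := Fin 2 → ℤ) one_ne_zero]
  refine ENNReal.tsum_le_tsum fun j => ?_
  rw [if_pos fun i hi => h i (ball_subset_cone k hm _ hi)]
  refine one_le_mul ?_ (EReal.one_le_exp_coe_ennreal _)
  rw [← ENNReal.ofReal_one]
  exact ENNReal.ofReal_le_ofReal (Real.one_le_rpow (by linarith [norm_nonneg j]) hα)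

namespace Network

variable {Ω : Type*} {m : ℕ} (S : Network Ω m) {p : SINRParams}

/-- Only finitely many nodes are at most as far away as `k`, by local finiteness, so a minimal
distance is attained. -/
theorem exists_isNearest {t : ℕ} {ω : Ω} (hinj : Function.Injective fun i => S.pos i ω)
    {φ : PointConfig} (hφ : Set.range (fun i => S.pos i ω) = φ.points) {i k : ℕ} (hk : k ≠ i)
    (hkc : S.pos k ω - S.pos i ω ∈ cone m (S.dest t i ω)) : ∃ j, S.IsNearest t i j ω := by
  set B := Metric.closedBall (S.pos i ω) (dist (S.pos i ω) (S.pos k ω))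
  have hfin : {l | l ≠ i ∧ S.pos l ω - S.pos i ω ∈ cone m (S.dest t i ω) ∧ S.pos l ω ∈ B}.Finite := by
    refine ((φ.locallyFinite B Metric.isBounded_closedBall).preimage
      (f := fun l => S.pos l ω) hinj.injOn).subset fun l hl => ?_
    exact ⟨hφ ▸ ⟨l, rfl⟩, hl.2.2⟩
  have hkB : S.pos k ω ∈ B := by
    rw [Metric.mem_closedBall, dist_comm]
  obtain ⟨j, ⟨hj1, hj2, hjB⟩, hmin⟩ := Set.exists_min_image _
    (fun l => dist (S.pos i ω) (S.pos l ω)) hfin ⟨k, hk, hkc, hkB⟩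
  refine ⟨j, hj1, hj2, fun l hl hlc => ?_⟩
  by_cases hlB : S.pos l ω ∈ B
  · exact hmin l ⟨hl, hlc, hlB⟩
  · rw [Metric.mem_closedBall, not_le, dist_comm (S.pos l ω)] at hlB
    rw [Metric.mem_closedBall, dist_comm (S.pos j ω)] at hjB
    exact hjB.trans hlB.le

/-- The factor of the shot noise in the bound for the inverse success probability. -/
noncomputable def _root_.SINRParams.noiseFactor (p : SINRParams) : ℝ≥0∞ :=
  ENNReal.ofReal (2 * p.mu / p.c) * (ENNReal.ofReal (p.beta * p.gamma) *
    (ENNReal.ofReal p.avgPower * ENNReal.ofReal (4 ^ p.alpha) *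
      ∫⁻ s, ENNReal.ofReal s ∂(expMeasure p.mu)))

theorem _root_.SINRParams.noiseFactor_ne_top (hμ : 0 < p.mu) : p.noiseFactor ≠ ∞ :=
  ENNReal.mul_ne_top ENNReal.ofReal_ne_top (ENNReal.mul_ne_top ENNReal.ofReal_ne_top
    (ENNReal.mul_ne_top (ENNReal.mul_ne_top ENNReal.ofReal_ne_top ENNReal.ofReal_ne_top)
      (mean_expMeasure_lt_top hμ).ne))

/-- The true cone and the cell of the true receiver give one term of the void sum. Summing over all
possibilities removes the dependence on `t` and on how the cone was chosen. -/
theorem regular_and_invSuccessBound_le (hm : Real.pi / m < Real.pi / 2) (hα : 0 < p.alpha)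
    (hμ : 0 < p.mu) (hM : 0 < p.avgPower) (he : p.eps < 1) {t : ℕ} {ω : Ω} {x : Plane}
    (hx : S.pos 0 ω = x) (hinj : Function.Injective fun i => S.pos i ω)
    {φ : PointConfig} (hφ : Set.range (fun i => S.pos i ω) = φ.points)
    (hfin : voidSum m p.alpha p.noiseFactor (fun i => S.pos i ω - x) ≠ ∞) :
    ω ∈ S.regular p t ∧
      S.invSuccessBound p t ω ≤ voidSum m p.alpha p.noiseFactor (fun i => S.pos i ω - x) := by
  have hc : 0 < p.c := mul_pos hM (inv_pos.mpr (sub_pos.mpr he))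
  set k := S.dest t 0 ω with hk
  have hex : ∃ l, S.pos l ω - x ∈ cone m k := by
    by_contra! hcon
    exact hfin (voidSum_eq_top hα.le k hm hcon)
  obtain ⟨l, hl⟩ := hex
  have hl0 : l ≠ 0 := by
    rintro rfl
    rw [hx, sub_self] at hl
    exact zero_notMem_cone m k hl
  have hnear : S.IsNearest t 0 (S.nn t 0 ω) ω :=
    Nat.sInf_mem (S.exists_isNearest hinj hφ hl0 (hx ▸ hl))
  set y := S.nn t 0 ω with hy
  obtain ⟨hy0, hyc, hmin⟩ := hnear
  rw [hx] at hyc hmin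
  set v := S.pos y ω - x with hv
  have hv0 : v ≠ 0 := by
    intro h0
    rw [h0] at hyc
    exact zero_notMem_cone m k hyc
  have hloss : S.loss p 0 y ω = pathLoss p.alpha ‖v‖ := by
    unfold loss
    rw [hx, dist_comm, dist_eq_norm]
  have hlpos : 0 < S.loss p 0 y ω := hloss ▸ pathLoss_pos _ (norm_pos_iff.mpr hv0)
  set j := latticeCell v with hj
  -- Since `‖j‖ ≤ ‖v‖ + 1`, a point of the ball has norm below `‖j‖ - 1 ≤ ‖v‖`. It also lies in the
  -- cone, so a node there would be closer than the nearest neighbour.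
  have hvoid : ∀ i, S.pos i ω - x ∉ Metric.ball (((‖j‖ - 1) / 2) • coneAxis m k)
        ((‖j‖ - 1) / 2 * Real.sin (Real.pi / m)) := by
    intro i hi
    have hic := ball_subset_cone k hm _ hi
    have hi0 : i ≠ 0 := by
      rintro rfl
      rw [hx, sub_self] at hic
      exact zero_notMem_cone m k hic
    have h1 := hmin i hi0 hic
    rw [dist_comm, dist_eq_norm, dist_comm, dist_eq_norm] at h1
    have hs : 0 ≤ (‖j‖ - 1) / 2 := by
      by_contra! hneg
      rw [Metric.mem_ball] at hi
      have h2 := dist_nonneg.trans_lt hi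
      have h3 : 0 ≤ Real.sin (Real.pi / m) := Real.sin_nonneg_of_nonneg_of_le_pi
        (by positivity) (by linarith [Real.pi_pos])
      nlinarith
    have h2 := norm_lt_of_mem_ball_coneAxis hs hi
    have h3 := norm_latticeCell_le v
    linarith
  have hle := le_voidSum (α := p.alpha) (A := p.noiseFactor) k j hvoid
  have hsum : ∑' z, ENNReal.ofReal (S.loss p z y ω) ≤ ENNReal.ofReal (4 ^ p.alpha) *
      ∑' z, ENNReal.ofReal (latticeDecay p.alpha (latticeCell (S.pos z ω - x) - j)) := by
    rw [← ENNReal.tsum_mul_left]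
    refine ENNReal.tsum_le_tsum fun z => ?_
    rw [← ENNReal.ofReal_mul (by positivity)]
    refine ENNReal.ofReal_le_ofReal ?_
    have := pathLoss_le_latticeDecay hα (S.pos z ω - x) v
    rwa [hv, dist_sub_right] at this
  have hexp : ENNReal.ofReal (2 * p.mu / p.c) * S.meanInterference p y ω ≤ p.noiseFactor *
      ∑' z, ENNReal.ofReal (latticeDecay p.alpha (latticeCell (S.pos z ω - x) - j)) := by
    unfold meanInterference SINRParams.noiseFactor
    calc _ ≤ ENNReal.ofReal (2 * p.mu / p.c) * (ENNReal.ofReal (p.beta * p.gamma) *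
          (ENNReal.ofReal p.avgPower * (ENNReal.ofReal (4 ^ p.alpha) *
          ∑' z, ENNReal.ofReal (latticeDecay p.alpha (latticeCell (S.pos z ω - x) - j))) *
          ∫⁻ s, ENNReal.ofReal s ∂(expMeasure p.mu))) := by gcongr
      _ = _ := by ring
  have hbound : S.invSuccessBound p t ω ≤
      voidSum m p.alpha p.noiseFactor (fun i => S.pos i ω - x) := by
    refine le_trans ?_ hle
    unfold invSuccessBound
    refine mul_le_mul' ?_ (EReal.exp_monotone (EReal.coe_ennreal_le_coe_ennreal_iff.mpr hexp))
    rw [← ENNReal.ofReal_inv_of_pos hlpos]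
    refine ENNReal.ofReal_le_ofReal ?_
    rw [hloss]
    exact inv_pathLoss_le hα.le hv0
  refine ⟨⟨hy0, hlpos, ?_⟩, hbound⟩
  -- The path loss is at most `1`, so the exponential alone is below the bound; finiteness of the
  -- void sum thus yields finite mean interference.
  have h1 : EReal.exp (ENNReal.ofReal (2 * p.mu / p.c) * S.meanInterference p y ω : ℝ≥0∞) ≤
      S.invSuccessBound p t ω := by
    unfold invSuccessBound
    refine le_mul_of_one_le_left' (ENNReal.one_le_inv.mpr ?_)
    rw [← ENNReal.ofReal_one]
    exact ENNReal.ofReal_le_ofReal (S.loss_le_one p _ _ _)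
  have h2 := EReal.exp_coe_ennreal_lt_top_iff.mp ((h1.trans hbound).trans_lt hfin.lt_top)
  rw [ENNReal.mul_lt_top_iff] at h2
  have h3 : ENNReal.ofReal (2 * p.mu / p.c) ≠ 0 := (ENNReal.ofReal_pos.mpr (by positivity)).ne'
  rcases h2 with h2 | h2 | h2
  · exact h2.2
  · exact absurd h2 h3
  · rw [h2]; exact ENNReal.zero_lt_top

end Network

/-! ### Measurability of the void sum and lattice counts -/

theorem measurable_latticeCell : Measurable latticeCell :=
  measurable_pi_iff.mpr fun i => Int.measurable_floor.comp (measurable_pi_apply i |>.comp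
    (PiLp.continuous_ofLp 2 _).measurable)

theorem measurable_exp_coe_ennreal : Measurable fun s : ℝ≥0∞ => EReal.exp (s : EReal) :=
  EReal.exp_monotone.measurable.comp measurable_coe_ennreal_ereal

theorem measurable_voidSum {Ω : Type*} [MeasurableSpace Ω] (m : ℕ) (α : ℝ) (A : ℝ≥0∞)
    {f : ℕ → Ω → Plane} (hf : ∀ i, Measurable (f i)) :
    Measurable fun ω => voidSum m α A (fun i => f i ω) := by
  unfold voidSum
  refine Measurable.tsum fun k => Measurable.tsum fun j => Measurable.ite ?_ ?_ measurable_const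
  · have : {ω | ∀ i, f i ω ∉ Metric.ball (((‖j‖ - 1) / 2) • coneAxis m k)
        ((‖j‖ - 1) / 2 * Real.sin (Real.pi / m))} =
        ⋂ i, f i ⁻¹' (Metric.ball (((‖j‖ - 1) / 2) • coneAxis m k)
        ((‖j‖ - 1) / 2 * Real.sin (Real.pi / m)))ᶜ := by
      ext ω
      simp
    exact (congrArg MeasurableSet this).mpr
      (MeasurableSet.iInter fun i => hf i Metric.isOpen_ball.measurableSet.compl)
  · refine (measurable_exp_coe_ennreal.comp (Measurable.const_mul ?_ _)).const_mul _
    refine Measurable.tsum fun i => ENNReal.measurable_ofReal.comp ?_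
    exact (measurable_of_countable (fun l : Fin 2 → ℤ => latticeDecay α (l - j))).comp
      (measurable_latticeCell.comp (hf i))

/-- In the cell `j = 0` the radius is nonpositive, so the ball is empty and its term is always
present. -/
theorem one_le_voidSum {m : ℕ} (hm : 0 < m) {α : ℝ} (hα : 0 ≤ α) (A : ℝ≥0∞) {ι : Type*}
    (f : ι → Plane) : 1 ≤ voidSum m α A f := by
  refine le_trans ?_ (le_voidSum ⟨0, hm⟩ 0 fun i hi => ?_)
  · refine one_le_mul ?_ (EReal.one_le_exp_coe_ennreal _)
    rw [← ENNReal.ofReal_one]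
    exact ENNReal.ofReal_le_ofReal (Real.one_le_rpow (by simp) hα)
  · rw [Metric.mem_ball] at hi
    have h2 := dist_nonneg.trans_lt hi
    have h3 : 0 ≤ Real.sin (Real.pi / m) := by
      refine Real.sin_nonneg_of_nonneg_of_le_pi (by positivity) ?_
      exact div_le_self Real.pi_pos.le (Nat.one_le_cast.mpr hm)
    rw [norm_zero] at h2
    nlinarith

namespace PointConfig

theorem measurable_count {A : Set Plane} (hA : MeasurableSet A) (hb : Bornology.IsBounded A) :
    Measurable fun φ : PointConfig => φ.count A :=
  Measurable.mono (comap_measurable (m := ⊤) (fun φ : PointConfig => φ.count A))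
    (le_iSup_of_le A (le_iSup_of_le hA (le_iSup_of_le hb le_rfl))) le_rfl

theorem count_eq_zero_iff (φ : PointConfig) {A : Set Plane} (hb : Bornology.IsBounded A) :
    φ.count A = 0 ↔ ∀ z : φ.points, (z : Plane) ∉ A := by
  unfold count
  rw [Set.ncard_eq_zero (φ.locallyFinite A hb), Set.eq_empty_iff_forall_notMem]
  constructor
  · exact fun h z hz => h z ⟨z.2, hz⟩
  · exact fun h z hz => h ⟨z, hz.1⟩ hz.2

end PointConfig

/-- The half-open unit square, shifted by `x`, of the points in the lattice cell `i`. -/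
def unitSquare (x : Plane) (i : Fin 2 → ℤ) : Set Plane := {z | latticeCell (z - x) = i}

theorem measurableSet_unitSquare (x : Plane) (i : Fin 2 → ℤ) : MeasurableSet (unitSquare x i) :=
  (measurable_latticeCell.comp (measurable_id.sub_const x)) (measurableSet_singleton i)

theorem isBounded_unitSquare (x : Plane) (i : Fin 2 → ℤ) : Bornology.IsBounded (unitSquare x i) := by
  refine (Metric.isBounded_closedBall (x := x) (r := 2 * (‖i‖ + 1))).subset fun z hz => ?_
  rw [Metric.mem_closedBall, dist_eq_norm]
  have hz' : latticeCell (z - x) = i := hz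
  rw [← hz']
  exact norm_le_two_mul_norm_latticeCell _

theorem pairwise_disjoint_unitSquare (x : Plane) :
    Pairwise fun i j => Disjoint (unitSquare x i) (unitSquare x j) := fun _ _ hij =>
  Set.disjoint_left.mpr fun _ hz hz' => hij (hz.symm.trans hz')

theorem volume_unitSquare_zero (i : Fin 2 → ℤ) : volume (unitSquare 0 i) = 1 := by
  have h : unitSquare 0 i = (MeasurableEquiv.toLp 2 (Fin 2 → ℝ)).symm ⁻¹'
      Set.univ.pi fun l => Set.Ico (i l : ℝ) (i l + 1) := by
    ext z
    simp only [unitSquare, sub_zero, latticeCell, Set.mem_preimage, Set.mem_univ_pi, Set.mem_Ico,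
      Set.mem_ofPred_eq, funext_iff, Int.floor_eq_iff]
    rfl
  rw [h, (EuclideanSpace.volume_preserving_symm_measurableEquiv_toLp (Fin 2)).measure_preimage
    (MeasurableSet.univ_pi fun l => measurableSet_Ico).nullMeasurableSet, Real.volume_pi_Ico]
  simp

namespace PointConfig

/-- Discretised shot noise is a function of countably many cell counts. This makes it measurable for
the σ-algebra of counts and accessible to the Poisson law. -/
theorem tsum_latticeCell (φ : PointConfig) (x : Plane) (g : (Fin 2 → ℤ) → ℝ≥0∞) :
    ∑' z : φ.points, g (latticeCell (z - x)) = ∑' i, (φ.count (unitSquare x i) : ℝ≥0∞) * g i := by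
  classical
  have h1 : ∀ i, (φ.count (unitSquare x i) : ℝ≥0∞) =
      ∑' z : φ.points, if latticeCell (z - x) = i then 1 else 0 := by
    intro i
    have hfin := φ.locallyFinite _ (isBounded_unitSquare x i)
    have h2 := ENNReal.tsum_set_one (φ.points ∩ unitSquare x i)
    rw [← hfin.cast_ncard_eq] at h2
    rw [tsum_subtype (φ.points ∩ unitSquare x i) (fun _ => (1 : ℝ≥0∞))] at h2
    rw [tsum_subtype φ.points (fun z => if latticeCell (z - x) = i then (1 : ℝ≥0∞) else 0)]
    unfold count
    refine Eq.trans (by simp) (h2.symm.trans (tsum_congr fun z => ?_))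
    by_cases hz : z ∈ φ.points <;> by_cases hc : latticeCell (z - x) = i <;>
      simp [Set.indicator, unitSquare, hz, hc]
  simp only [h1, ← ENNReal.tsum_mul_right]
  rw [ENNReal.tsum_comm]
  refine tsum_congr fun z => ?_
  rw [tsum_eq_single (latticeCell (z - x))]
  · simp
  · intro i hi
    rw [if_neg hi.symm, zero_mul]

theorem measurable_voidSum (m : ℕ) (α : ℝ) (A : ℝ≥0∞) (x : Plane) :
    Measurable fun φ : PointConfig => voidSum m α A (fun z : φ.points => (z : Plane) - x) := by
  unfold voidSum
  refine Measurable.tsum fun k => Measurable.tsum fun j => Measurable.ite ?_ ?_ measurable_const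
  · set c := ((‖j‖ - 1) / 2) • coneAxis m k
    set r := (‖j‖ - 1) / 2 * Real.sin (Real.pi / m)
    have : {φ : PointConfig | ∀ z : φ.points, (z : Plane) - x ∉ Metric.ball c r} =
        (fun φ : PointConfig => φ.count (Metric.ball (c + x) r)) ⁻¹' {0} := by
      ext φ
      simp only [Set.mem_preimage, Set.mem_singleton_iff, Set.mem_ofPred_eq,
        φ.count_eq_zero_iff Metric.isBounded_ball, Metric.mem_ball, dist_eq_norm]
      simp only [sub_sub, add_comm]
    exact (congrArg MeasurableSet this).mpr
      (measurable_count Metric.isOpen_ball.measurableSet Metric.isBounded_ball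
        (measurableSet_singleton 0))
  · refine (measurable_exp_coe_ennreal.comp (Measurable.const_mul ?_ _)).const_mul _
    simp only [tsum_latticeCell _ x fun l => ENNReal.ofReal (latticeDecay α (l - j))]
    exact Measurable.tsum fun i => ((measurable_of_countable (fun n : ℕ => (n : ℝ≥0∞))).comp
      (measurable_count (measurableSet_unitSquare x i) (isBounded_unitSquare x i))).mul_const _

end PointConfig

/-! ### From the Palm distribution to the Poisson process -/

theorem sum_lintegral_le_lintegral_sum {Ω ι : Type*} [MeasurableSpace Ω] (μ : Measure Ω)
    (s : Finset ι) (f : ι → Ω → ℝ≥0∞) :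
    ∑ i ∈ s, ∫⁻ ω, f i ω ∂μ ≤ ∫⁻ ω, ∑ i ∈ s, f i ω ∂μ := by
  classical
  induction s using Finset.induction_on with
  | empty => simp
  | insert a s ha ih =>
    simp only [Finset.sum_insert ha]
    exact (add_le_add le_rfl ih).trans (le_lintegral_add _ _)

/-- One half of the Campbell formula for functionals of the configuration; no measurability of
the functionals is needed. -/
theorem IsPalmLaw.lintegral_le {lam : ℝ} {P Q : Measure PointConfig} {x : Plane}
    (h : IsPalmLaw lam P x Q) {B : Set Plane} (hB : MeasurableSet B)
    (hBb : Bornology.IsBounded B) {F G : PointConfig → ℝ≥0∞}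
    (hFG : ∀ φ : PointConfig, ∀ y ∈ φ.points ∩ B, F (φ.translate (x - y)) ≤ G φ) :
    ENNReal.ofReal lam * volume B * ∫⁻ φ, F φ ∂Q ≤ ∫⁻ φ, φ.count B * G φ ∂P := by
  classical
  -- The integral is a supremum over simple functions below `F`. The Campbell formula applies to
  -- each fibre of such a function, and the fibres regroup into a sum over the points in `B`.
  rw [lintegral, ENNReal.mul_iSup]
  refine iSup_le fun g => ?_
  rw [ENNReal.mul_iSup]
  refine iSup_le fun hg => ?_
  rw [SimpleFunc.lintegral, Finset.mul_sum]
  calc ∑ c ∈ g.range, ENNReal.ofReal lam * volume B * (c * Q (g ⁻¹' {c}))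
      = ∑ c ∈ g.range, c * ∫⁻ φ, (({y | y ∈ φ.points ∩ B ∧
          φ.translate (x - y) ∈ g ⁻¹' {c}}.ncard : ℕ) : ℝ≥0∞) ∂P := by
        refine Finset.sum_congr rfl fun c _ => ?_
        rw [h.campbell B hB hBb _ (g.measurableSet_fiber c)]
        ring
    _ ≤ ∑ c ∈ g.range, ∫⁻ φ, c * (({y | y ∈ φ.points ∩ B ∧
          φ.translate (x - y) ∈ g ⁻¹' {c}}.ncard : ℕ) : ℝ≥0∞) ∂P :=
        Finset.sum_le_sum fun c _ => lintegral_const_mul_le _ _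
    _ ≤ ∫⁻ φ, ∑ c ∈ g.range, c * (({y | y ∈ φ.points ∩ B ∧
          φ.translate (x - y) ∈ g ⁻¹' {c}}.ncard : ℕ) : ℝ≥0∞) ∂P :=
        sum_lintegral_le_lintegral_sum _ _ _
    _ ≤ ∫⁻ φ, φ.count B * G φ ∂P := by
        refine lintegral_mono fun φ => ?_
        have hfin := φ.locallyFinite B hBb
        set T := hfin.toFinset with hT
        have hcard : ∀ c, {y | y ∈ φ.points ∩ B ∧ φ.translate (x - y) ∈ g ⁻¹' {c}}.ncard =
            (T.filter fun y => g (φ.translate (x - y)) = c).card := by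
          intro c
          rw [← Set.ncard_coe_finset]
          congr 1
          ext y
          simp [hT]
        have hcount : φ.count B = T.card := by
          unfold PointConfig.count
          rw [Set.ncard_eq_toFinset_card _ hfin]
        rw [hcount]
        calc ∑ c ∈ g.range, c * (({y | y ∈ φ.points ∩ B ∧
              φ.translate (x - y) ∈ g ⁻¹' {c}}.ncard : ℕ) : ℝ≥0∞)
            = ∑ c ∈ g.range, ∑ y ∈ T with g (φ.translate (x - y)) = c,
                g (φ.translate (x - y)) := by
              refine Finset.sum_congr rfl fun c _ => ?_
              rw [hcard c, Finset.sum_congr rfl (g := fun _ => c)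
                (fun y hy => (Finset.mem_filter.mp hy).2), Finset.sum_const, nsmul_eq_mul, mul_comm]
          _ = ∑ y ∈ T, g (φ.translate (x - y)) :=
              Finset.sum_fiberwise_of_maps_to (fun y _ => g.mem_range_self _) _
          _ ≤ ∑ y ∈ T, G φ := Finset.sum_le_sum fun y hy =>
              (hg _).trans (hFG φ y (hfin.mem_toFinset.mp hy))
          _ = _ := by rw [Finset.sum_const, nsmul_eq_mul]

/-! ### Void probabilities and exponential moments of Poisson counts -/

theorem lintegral_exp_poissonMeasure (r : ℝ≥0) (g : ℝ) :
    ∫⁻ n, ENNReal.ofReal (Real.exp (n * g)) ∂(poissonMeasure r) =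
      ENNReal.ofReal (Real.exp (r * (Real.exp g - 1))) := by
  have hs := (NormedSpace.expSeries_div_hasSum_exp ((r : ℝ) * Real.exp g)).mul_left (Real.exp (-r))
  rw [← Real.exp_eq_exp_ℝ, ← Real.exp_add] at hs
  rw [lintegral_countable', mul_sub, mul_one, sub_eq_neg_add, ← hs.tsum_eq,
    ENNReal.ofReal_tsum_of_nonneg (fun n => by positivity) hs.summable]
  refine tsum_congr fun n => ?_
  rw [poissonMeasure_singleton, ← ENNReal.ofReal_mul (Real.exp_pos _).le]
  congr 1
  rw [mul_pow, ← Real.exp_nat_mul]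
  ring

namespace IsPoissonLaw

variable {lam : ℝ} {P : Measure PointConfig}

theorem lintegral_exp_count (h : IsPoissonLaw lam P) (hlam : 0 ≤ lam) {A : Set Plane}
    (hA : MeasurableSet A) (hb : Bornology.IsBounded A) (g : ℝ) :
    ∫⁻ φ, ENNReal.ofReal (Real.exp (φ.count A * g)) ∂P =
      ENNReal.ofReal (Real.exp (lam * (volume : Measure Plane).real A * (Real.exp g - 1))) := by
  have h1 := (h.count_law A hA hb).lintegral_comp
    (f := fun n : ℕ => ENNReal.ofReal (Real.exp (n * g))) (measurable_of_countable _).aemeasurable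
  rw [h1, lintegral_exp_poissonMeasure, Real.coe_toNNReal _ (by positivity)]

theorem measure_count_eq_zero (h : IsPoissonLaw lam P) (hlam : 0 ≤ lam) {A : Set Plane}
    (hA : MeasurableSet A) (hb : Bornology.IsBounded A) :
    P {φ | φ.count A = 0} =
      ENNReal.ofReal (Real.exp (-(lam * (volume : Measure Plane).real A))) := by
  have h1 := (h.count_law A hA hb).map_eq
  have h2 : P {φ | φ.count A = 0} = (P.map fun φ : PointConfig => φ.count A) {0} :=
    (Measure.map_apply (PointConfig.measurable_count hA hb) (measurableSet_singleton 0)).symm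
  rw [h2, h1, poissonMeasure_singleton, Real.coe_toNNReal _ (by positivity)]
  simp

theorem lintegral_prod_exp_count (h : IsPoissonLaw lam P) (hlam : 0 ≤ lam) {ι : Type*}
    {A : ι → Set Plane} (hA : ∀ i, MeasurableSet (A i)) (hb : ∀ i, Bornology.IsBounded (A i))
    (hd : Pairwise fun i j => Disjoint (A i) (A j)) (g : ι → ℝ) (s : Finset ι) :
    ∫⁻ φ, ∏ i ∈ s, ENNReal.ofReal (Real.exp (φ.count (A i) * g i)) ∂P =
      ∏ i ∈ s, ENNReal.ofReal
        (Real.exp (lam * (volume : Measure Plane).real (A i) * (Real.exp (g i) - 1))) := by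
  classical
  set e := s.equivFin.symm with he
  have hind := h.count_indep s.card (fun l => A (e l)) (fun l => hA _) (fun l => hb _)
    fun l l' hl => hd fun heq => hl (e.injective (Subtype.ext heq))
  have hind2 := hind.comp (fun l (n : ℕ) => ENNReal.ofReal (Real.exp (n * g (e l))))
    fun l => measurable_of_countable _
  have hprod := lintegral_prod_eq_prod_lintegral_of_indepFun Finset.univ _ hind2
    fun l => (measurable_of_countable _).comp (PointConfig.measurable_count (hA _) (hb _))
  have hre : ∀ f : ι → ℝ≥0∞, ∏ i ∈ s, f i = ∏ l, f (e l) := by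
    intro f
    rw [← Finset.prod_coe_sort s f]
    exact (e.prod_comp fun i : s => f i).symm
  simp only [hre]
  refine hprod.trans (Finset.prod_congr rfl fun l _ => ?_)
  exact h.lintegral_exp_count hlam (hA _) (hb _) _

end IsPoissonLaw

theorem EReal.exp_sum_mul_ofReal {ι : Type*} (s : Finset ι) (n : ι → ℕ) {g : ι → ℝ}
    (hg : ∀ i, 0 ≤ g i) :
    EReal.exp ((∑ i ∈ s, (n i : ℝ≥0∞) * ENNReal.ofReal (g i) : ℝ≥0∞) : EReal) =
      ∏ i ∈ s, ENNReal.ofReal (Real.exp (n i * g i)) := by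
  classical
  induction s using Finset.induction_on with
  | empty => simp
  | insert a s ha ih =>
    rw [Finset.sum_insert ha, Finset.prod_insert ha, EReal.coe_ennreal_add, EReal.exp_add, ih,
      EReal.exp_coe_ennreal (ENNReal.mul_ne_top (ENNReal.natCast_ne_top _) ENNReal.ofReal_ne_top),
      ENNReal.toReal_mul, ENNReal.toReal_natCast, ENNReal.toReal_ofReal (hg a)]

/-- By continuity of `EReal.exp`, also at `∞`, the exponential of the series becomes a directed
supremum of finite products, ready for monotone convergence. -/
theorem EReal.exp_tsum_mul_ofReal {ι : Type*} (n : ι → ℕ) {g : ι → ℝ} (hg : ∀ i, 0 ≤ g i) :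
    EReal.exp ((∑' i, (n i : ℝ≥0∞) * ENNReal.ofReal (g i) : ℝ≥0∞) : EReal) =
      ⨆ s : Finset ι, ∏ i ∈ s, ENNReal.ofReal (Real.exp (n i * g i)) := by
  simp only [← EReal.exp_sum_mul_ofReal _ n hg]
  have hmono : Monotone fun s : Finset ι =>
      EReal.exp ((∑ i ∈ s, (n i : ℝ≥0∞) * ENNReal.ofReal (g i) : ℝ≥0∞) : EReal) := fun s t hst =>
    EReal.exp_monotone (EReal.coe_ennreal_le_coe_ennreal_iff.mpr
      (Finset.sum_le_sum_of_subset hst))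
  have hcont : Continuous EReal.exp := EReal.expHomeomorph.continuous
  exact tendsto_nhds_unique
    (((hcont.comp continuous_coe_ennreal_ereal).tendsto _).comp ENNReal.summable.hasSum)
    (tendsto_atTop_iSup hmono)

namespace IsPoissonLaw

variable {lam : ℝ} {P : Measure PointConfig}

/-- For finitely many cells, independence gives `exp (λ ∑ (exp gᵢ - 1))`, and `exp g - 1 ≤ g exp g ≤
g exp b` makes the exponent linear in `g`. Monotone convergence passes to all cells. -/
theorem lintegral_exp_tsum_count_le (h : IsPoissonLaw lam P) (hlam : 0 ≤ lam) {ι : Type*}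
    [Countable ι] {A : ι → Set Plane} (hA : ∀ i, MeasurableSet (A i))
    (hb : ∀ i, Bornology.IsBounded (A i)) (hd : Pairwise fun i j => Disjoint (A i) (A j))
    (hvol : ∀ i, (volume : Measure Plane).real (A i) = 1) {g : ι → ℝ} (hg : ∀ i, 0 ≤ g i)
    {b : ℝ} (hgb : ∀ i, g i ≤ b) (hs : Summable g) :
    ∫⁻ φ, EReal.exp ((∑' i, (φ.count (A i) : ℝ≥0∞) * ENNReal.ofReal (g i) : ℝ≥0∞) : EReal) ∂P ≤
      ENNReal.ofReal (Real.exp (lam * (Real.exp b * ∑' i, g i))) := by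
  have hone : ∀ (i : ι) (φ : PointConfig),
      1 ≤ ENNReal.ofReal (Real.exp (φ.count (A i) * g i)) := by
    intro i φ
    rw [← ENNReal.ofReal_one]
    exact ENNReal.ofReal_le_ofReal (Real.one_le_exp (mul_nonneg (Nat.cast_nonneg _) (hg i)))
  have hmono : Monotone fun (s : Finset ι) (φ : PointConfig) =>
      ∏ i ∈ s, ENNReal.ofReal (Real.exp (φ.count (A i) * g i)) := fun s t hst φ =>
    Finset.prod_le_prod_of_subset_of_one_le' hst fun i _ _ => hone i φ
  simp only [EReal.exp_tsum_mul_ofReal _ hg]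
  rw [lintegral_iSup_directed _ hmono.directed_le]
  · refine iSup_le fun s => ?_
    rw [h.lintegral_prod_exp_count hlam hA hb hd g s,
      ← ENNReal.ofReal_prod_of_nonneg fun _ _ => (Real.exp_pos _).le, ← Real.exp_sum]
    refine ENNReal.ofReal_le_ofReal (Real.exp_le_exp.mpr ?_)
    calc ∑ i ∈ s, lam * (volume : Measure Plane).real (A i) * (Real.exp (g i) - 1)
        ≤ ∑ i ∈ s, lam * (Real.exp b * g i) := by
          refine Finset.sum_le_sum fun i _ => ?_
          rw [hvol i, mul_one]
          refine mul_le_mul_of_nonneg_left ?_ hlam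
          have h1 : 1 - g i ≤ Real.exp (-(g i)) := by linarith [Real.add_one_le_exp (-(g i))]
          have h2 : Real.exp (g i) * Real.exp (-(g i)) = 1 := by rw [← Real.exp_add]; simp
          have h3 : Real.exp (g i) ≤ Real.exp b := Real.exp_le_exp.mpr (hgb i)
          nlinarith [Real.exp_pos (g i), hg i, mul_le_mul_of_nonneg_left h1 (Real.exp_pos (g i)).le,
            mul_le_mul_of_nonneg_right h3 (hg i)]
      _ = lam * (Real.exp b * ∑ i ∈ s, g i) := by rw [← Finset.mul_sum, ← Finset.mul_sum]
      _ ≤ _ := by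
          gcongr
          exact hs.sum_le_tsum _ fun i _ => hg i
  · intro s
    exact (Finset.measurable_fun_prod _ fun i _ =>
      (measurable_of_countable (fun n : ℕ => ENNReal.ofReal (Real.exp (n * g i)))).comp
        (PointConfig.measurable_count (hA i) (hb i))).aemeasurable

/-- The set `D` may cut through the cells, so its count need not be independent of theirs;
Cauchy–Schwarz separates the factors. This halves the void exponent and doubles `g`. -/
theorem lintegral_void_mul_exp_tsum_count_le (h : IsPoissonLaw lam P) (hlam : 0 ≤ lam) {ι : Type*}
    [Countable ι] {A : ι → Set Plane} (hA : ∀ i, MeasurableSet (A i))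
    (hb : ∀ i, Bornology.IsBounded (A i)) (hd : Pairwise fun i j => Disjoint (A i) (A j))
    (hvol : ∀ i, (volume : Measure Plane).real (A i) = 1) {g : ι → ℝ} (hg : ∀ i, 0 ≤ g i)
    {b : ℝ} (hgb : ∀ i, g i ≤ b) (hs : Summable g) {D : Set Plane} (hD : MeasurableSet D)
    (hDb : Bornology.IsBounded D) :
    ∫⁻ φ, {φ : PointConfig | φ.count D = 0}.indicator 1 φ *
      EReal.exp ((∑' i, (φ.count (A i) : ℝ≥0∞) * ENNReal.ofReal (g i) : ℝ≥0∞) : EReal) ∂P ≤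
      ENNReal.ofReal (Real.exp (-(lam * (volume : Measure Plane).real D) / 2)) *
        ENNReal.ofReal (Real.exp (lam * (Real.exp (2 * b) * ∑' i, g i))) := by
  have hV : MeasurableSet {φ : PointConfig | φ.count D = 0} :=
    PointConfig.measurable_count hD hDb (measurableSet_singleton 0)
  have hE : Measurable fun φ : PointConfig =>
      EReal.exp ((∑' i, (φ.count (A i) : ℝ≥0∞) * ENNReal.ofReal (g i) : ℝ≥0∞) : EReal) :=
    measurable_exp_coe_ennreal.comp (Measurable.tsum fun i =>
      ((measurable_of_countable (fun n : ℕ => (n : ℝ≥0∞))).comp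
        (PointConfig.measurable_count (hA i) (hb i))).mul_const _)
  have hholder := ENNReal.lintegral_mul_le_Lp_mul_Lq P Real.HolderConjugate.two_two
    ((measurable_one.indicator hV).aemeasurable) hE.aemeasurable
  refine hholder.trans (mul_le_mul' (le_of_eq ?_) ?_)
  · have h1 : ∀ φ : PointConfig, ({φ : PointConfig | φ.count D = 0}.indicator
        (1 : PointConfig → ℝ≥0∞) φ) ^ (2 : ℝ) = {φ : PointConfig | φ.count D = 0}.indicator 1 φ := by
      intro φ
      by_cases hφ : φ ∈ {φ : PointConfig | φ.count D = 0} <;> simp [hφ]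
    simp only [h1]
    rw [lintegral_indicator_one hV, h.measure_count_eq_zero hlam hD hDb,
      ENNReal.ofReal_rpow_of_nonneg (Real.exp_pos _).le (by norm_num), ← Real.exp_mul]
    congr 2
    ring
  · have h2 : ∀ φ : PointConfig, (EReal.exp ((∑' i, (φ.count (A i) : ℝ≥0∞) *
        ENNReal.ofReal (g i) : ℝ≥0∞) : EReal)) ^ (2 : ℝ) = EReal.exp ((∑' i,
        (φ.count (A i) : ℝ≥0∞) * ENNReal.ofReal (2 * g i) : ℝ≥0∞) : EReal) := by
      intro φ
      rw [ENNReal.rpow_ofNat, sq, ← EReal.exp_add, ← EReal.coe_ennreal_add, ← two_mul,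
        ← ENNReal.tsum_mul_left]
      congr 3
      funext i
      rw [ENNReal.ofReal_mul two_pos.le, ENNReal.ofReal_ofNat]
      ring
    simp only [h2]
    have h3 := h.lintegral_exp_tsum_count_le hlam hA hb hd hvol (g := fun i => 2 * g i)
      (fun i => by linarith [hg i]) (b := 2 * b) (fun i => by linarith [hgb i]) (hs.mul_left 2)
    refine (ENNReal.rpow_le_rpow h3 (by norm_num)).trans_eq ?_
    rw [ENNReal.ofReal_rpow_of_nonneg (Real.exp_pos _).le (by norm_num), ← Real.exp_mul,
      tsum_mul_left]
    congr 2
    ring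

end IsPoissonLaw

/-! ### Finite mean of the void sum -/

theorem summable_latticeDecay {α : ℝ} (hα : 2 < α) : Summable (latticeDecay α) := by
  refine (EisensteinSeries.summable_one_div_norm_rpow hα).of_norm_bounded_eventually ?_
  have : ∀ᶠ i : Fin 2 → ℤ in Filter.cofinite, i ≠ 0 := by
    simp
  filter_upwards [this] with i hi
  rw [Real.norm_of_nonneg (latticeDecay_nonneg _ _)]
  exact Real.rpow_le_rpow_of_nonpos (norm_pos_iff.mpr hi) (by linarith) (by linarith)

/-- Use `1 + u ≤ exp u` and complete the square in the exponent. -/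
theorem one_add_rpow_mul_exp_neg_sq_le {p κ u : ℝ} (hp : 0 ≤ p) (hκ : 0 < κ) (hu : 0 ≤ u) :
    (1 + u) ^ p * Real.exp (-(κ * u ^ 2)) ≤ Real.exp (p ^ 2 / (4 * κ)) := by
  have h1 : (1 + u) ^ p ≤ Real.exp (p * u) := by
    rw [mul_comm, Real.exp_mul]
    exact Real.rpow_le_rpow (by linarith) (by linarith [Real.add_one_le_exp u]) hp
  calc (1 + u) ^ p * Real.exp (-(κ * u ^ 2)) ≤ Real.exp (p * u) * Real.exp (-(κ * u ^ 2)) := by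
        gcongr
    _ = Real.exp (p * u - κ * u ^ 2) := by rw [← Real.exp_add]; ring_nf
    _ ≤ _ := by
        refine Real.exp_le_exp.mpr ?_
        rw [le_div_iff₀ (by positivity)]
        nlinarith [sq_nonneg (p - 2 * κ * u)]

/-- The Gaussian absorbs a power of degree `α + 3`, which leaves a summable lattice decay of
exponent `3`; any exponent above `2` would do. -/
theorem summable_rpow_mul_exp_neg_sq {α κ σ : ℝ} (hα : 0 ≤ α) (hκ : 0 < κ) (hσ : 0 < σ) :
    Summable fun j : Fin 2 → ℤ => (2 * (‖j‖ + 1)) ^ α *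
      Real.exp (-(κ * (max ((‖j‖ - 1) / 2 * σ - 2) 0) ^ 2)) := by
  set c := 2 * σ⁻¹ + 4 * σ⁻¹ + 2 with hc
  have hc0 : 0 < c := by positivity
  refine Summable.of_nonneg_of_le (fun j => by positivity) (fun j => ?_)
    ((summable_latticeDecay (α := 3) (by norm_num)).mul_left
      (2 ^ α * (c ^ (α + 3) * Real.exp ((α + 3) ^ 2 / (4 * κ)))))
  set T := 1 + ‖j‖ with hT
  have hT0 : 0 < T := by positivity
  set u := max ((‖j‖ - 1) / 2 * σ - 2) 0 with hu
  have hu0 : 0 ≤ u := le_max_right _ _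
  have hTu : T ≤ c * (1 + u) := by
    have h1 : (‖j‖ - 1) / 2 * σ - 2 ≤ u := le_max_left _ _
    have h2 : ‖j‖ ≤ (2 * u + 4) * σ⁻¹ + 1 := by
      rw [← sub_le_iff_le_add, ← div_eq_mul_inv, le_div_iff₀ hσ]
      linarith
    have h3 : 0 < σ⁻¹ := inv_pos.mpr hσ
    rw [hc, hT]
    nlinarith [mul_nonneg hu0 h3.le]
  have h1 : T ^ (α + 3) * Real.exp (-(κ * u ^ 2)) ≤
      c ^ (α + 3) * Real.exp ((α + 3) ^ 2 / (4 * κ)) := by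
    calc T ^ (α + 3) * Real.exp (-(κ * u ^ 2))
        ≤ (c * (1 + u)) ^ (α + 3) * Real.exp (-(κ * u ^ 2)) := by gcongr
      _ = c ^ (α + 3) * ((1 + u) ^ (α + 3) * Real.exp (-(κ * u ^ 2))) := by
          rw [Real.mul_rpow hc0.le (by linarith), mul_assoc]
      _ ≤ _ := by
          gcongr
          exact one_add_rpow_mul_exp_neg_sq_le (by linarith) hκ hu0
  have h2 : (2 * (‖j‖ + 1)) ^ α = 2 ^ α * (T ^ (α + 3) * T ^ (-3 : ℝ)) := by
    rw [← Real.rpow_add hT0, add_neg_cancel_right, Real.mul_rpow two_pos.le (by positivity), hT,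
      add_comm]
  have h3 : latticeDecay 3 j = T ^ (-3 : ℝ) := rfl
  rw [h2, h3]
  have h4 : (0 : ℝ) < T ^ (-3 : ℝ) := by positivity
  calc _ = 2 ^ α * (T ^ (α + 3) * Real.exp (-(κ * u ^ 2))) * T ^ (-3 : ℝ) := by ring
    _ ≤ _ := by gcongr

theorem ball_subset_ball_of_norm_le {c z w : Plane} {r d : ℝ} (hw : ‖w‖ ≤ d)
    (hz : z ∈ Metric.ball c (r - d)) : z - w ∈ Metric.ball c r := by
  rw [Metric.mem_ball, dist_eq_norm] at hz ⊢
  have : z - w - c = (z - c) - w := by abel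
  rw [this]
  exact (norm_sub_le _ _).trans_lt (by linarith)

theorem norm_latticeCell_sub_sub_le_one {z w : Plane} (hw : latticeCell w = 0) :
    ‖latticeCell (z - w) - latticeCell z‖ ≤ 1 := by
  refine (pi_norm_le_iff_of_nonneg zero_le_one).mpr fun i => ?_
  have hwi : ⌊w i⌋ = 0 := congrFun hw i
  obtain ⟨h1, h2⟩ := Int.floor_eq_zero_iff.mp hwi
  have h3 : ⌊z i - w i⌋ ≤ ⌊z i⌋ := Int.floor_le_floor (by linarith)
  have h4 : ⌊z i⌋ - 1 ≤ ⌊z i - w i⌋ := by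
    rw [← Int.floor_sub_one]
    exact Int.floor_le_floor (by linarith)
  rw [Int.norm_eq_abs]
  simp only [latticeCell, Pi.sub_apply, PiLp.sub_apply]
  rw [← Int.cast_abs]
  have : |⌊z i - w i⌋ - ⌊z i⌋| ≤ 1 := abs_le.mpr ⟨by omega, by omega⟩
  exact_mod_cast this

/-- The void sum at a shifted point of the unit square, bounded by counts in lattice cells. -/
theorem voidSum_translate_le {m : ℕ} {α : ℝ} (hα : 0 ≤ α) (A : ℝ≥0) (φ : PointConfig)
    (x w : Plane) (hw : w ∈ unitSquare 0 0) :
    voidSum m α A (fun z : (φ.translate (x - w)).points => (z : Plane) - x) ≤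
      ∑' (k : Fin m) (j : Fin 2 → ℤ), ENNReal.ofReal ((2 * (‖j‖ + 1)) ^ α) *
        ({φ : PointConfig | φ.count (Metric.ball (((‖j‖ - 1) / 2) • coneAxis m k)
          ((‖j‖ - 1) / 2 * Real.sin (Real.pi / m) - 2)) = 0}.indicator 1 φ *
        EReal.exp ((∑' i, (φ.count (unitSquare 0 i) : ℝ≥0∞) *
          ENNReal.ofReal (A * 2 ^ α * latticeDecay α (i - j)) : ℝ≥0∞) : EReal)) := by
  classical
  have hwc : latticeCell w = 0 := by
    have : latticeCell (w - 0) = 0 := hw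
    rwa [sub_zero] at this
  -- Source of the `2` subtracted from the radius: recentring at a point of the unit square shifts
  -- the void ball by at most this much.
  have hwn : ‖w‖ ≤ 2 := by
    have := norm_le_two_mul_norm_latticeCell w
    rw [hwc, norm_zero] at this
    linarith
  have hinj : Function.Injective fun y : Plane => y + (x - w) := add_left_injective _
  set e : φ.points ≃ (φ.translate (x - w)).points := Equiv.Set.image _ φ.points hinj
  have he : ∀ z : φ.points, ((e z : Plane)) - x = z - w := fun z => by
    change (z : Plane) + (x - w) - x = z - w
    abel
  rw [← voidSum_comp_equiv m α A e]
  simp only [he]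
  unfold voidSum
  refine ENNReal.tsum_le_tsum fun k => ENNReal.tsum_le_tsum fun j => ?_
  split_ifs with hv
  swap
  · exact zero_le
  have hmem : φ ∈ {φ : PointConfig | φ.count (Metric.ball (((‖j‖ - 1) / 2) • coneAxis m k)
          ((‖j‖ - 1) / 2 * Real.sin (Real.pi / m) - 2)) = 0} :=
    (φ.count_eq_zero_iff Metric.isBounded_ball).mpr fun z hz =>
      hv z (ball_subset_ball_of_norm_le hwn hz)
  rw [Set.indicator_of_mem hmem, Pi.one_apply, one_mul]
  refine mul_le_mul' le_rfl (EReal.exp_monotone (EReal.coe_ennreal_le_coe_ennreal_iff.mpr ?_))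
  rw [← φ.tsum_latticeCell 0 fun l => ENNReal.ofReal (A * 2 ^ α * latticeDecay α (l - j)),
    ← ENNReal.tsum_mul_left]
  refine ENNReal.tsum_le_tsum fun z => ?_
  rw [sub_zero, mul_assoc, ENNReal.ofReal_mul A.coe_nonneg, ENNReal.ofReal_coe_nnreal]
  gcongr
  -- Recentring changes each cell index by at most `1`, at the price of the factor `2 ^ α`.
  refine latticeDecay_le_of_norm_sub_le hα ?_
  rw [sub_sub_sub_cancel_right]
  exact norm_latticeCell_sub_sub_le_one hwc

theorem IsPalmLaw.lintegral_voidSum_lt_top {lam : ℝ} (hlam : 0 < lam) {P Q : Measure PointConfig}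
    {x : Plane} (hQ : IsPalmLaw lam P x Q) (hP : IsPoissonLaw lam P) {m : ℕ}
    (hm : Real.pi / m < Real.pi) {α : ℝ} (hα : 2 < α) {A : ℝ≥0∞} (hA : A ≠ ∞) :
    ∫⁻ φ, voidSum m α A (fun z : φ.points => (z : Plane) - x) ∂Q < ∞ := by
  classical
  lift A to ℝ≥0 using hA
  set a : ℝ := A * 2 ^ α with ha
  have ha0 : 0 ≤ a := by positivity
  set D : Fin m → (Fin 2 → ℤ) → Set Plane := fun k j =>
    Metric.ball (((‖j‖ - 1) / 2) • coneAxis m k) ((‖j‖ - 1) / 2 * Real.sin (Real.pi / m) - 2)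
  -- The extra unit weight on cell `0` absorbs the count factor from the Campbell formula, through
  -- `n ≤ exp n`. By translation invariance the total weight does not depend on `j`, so the constant
  -- `K` serves every cell.
  set g : (Fin 2 → ℤ) → (Fin 2 → ℤ) → ℝ := fun j i =>
    a * latticeDecay α (i - j) + if i = 0 then 1 else 0 with hg
  have hg0 : ∀ j i, 0 ≤ g j i := fun j i =>
    add_nonneg (mul_nonneg ha0 (latticeDecay_nonneg _ _)) (by split_ifs <;> norm_num)
  have hgb : ∀ j i, g j i ≤ a + 1 := by
    intro j i
    refine add_le_add (mul_le_of_le_one_right ha0 (latticeDecay_le_one (by linarith) _)) ?_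
    split_ifs <;> norm_num
  have hsd : ∀ j : Fin 2 → ℤ, Summable fun i => a * latticeDecay α (i - j) := fun j =>
    (((Equiv.subRight j).summable_iff (f := latticeDecay α)).mpr
      (summable_latticeDecay hα)).mul_left a
  have hsi : Summable fun i : Fin 2 → ℤ => if i = 0 then (1 : ℝ) else 0 :=
    summable_of_hasFiniteSupport ((Set.finite_singleton 0).subset fun i hi => by
      by_contra hne
      exact hi (if_neg hne))
  have hgs : ∀ j, Summable (g j) := fun j => (hsd j).add hsi
  have hgt : ∀ j, ∑' i, g j i = a * ∑' i, latticeDecay α i + 1 := by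
    intro j
    rw [(hsd j).tsum_add hsi, tsum_mul_left, tsum_ite_eq]
    congr 2
    exact (Equiv.subRight j).tsum_eq (latticeDecay α)
  set K := ENNReal.ofReal (Real.exp (lam * (Real.exp (2 * (a + 1)) *
    (a * ∑' i, latticeDecay α i + 1))))
  have hsq := fun i => measurableSet_unitSquare 0 i
  have hsqb := fun i => isBounded_unitSquare 0 i
  have hterm : ∀ k j, ∫⁻ φ, (φ.count (unitSquare 0 0) : ℝ≥0∞) *
      (ENNReal.ofReal ((2 * (‖j‖ + 1)) ^ α) *
        ({φ : PointConfig | φ.count (D k j) = 0}.indicator 1 φ *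
        EReal.exp ((∑' i, (φ.count (unitSquare 0 i) : ℝ≥0∞) *
          ENNReal.ofReal (a * latticeDecay α (i - j)) : ℝ≥0∞) : EReal))) ∂P ≤
      ENNReal.ofReal ((2 * (‖j‖ + 1)) ^ α * Real.exp (-(lam * Real.pi / 2 *
        (max ((‖j‖ - 1) / 2 * Real.sin (Real.pi / m) - 2) 0) ^ 2))) * K := by
    intro k j
    have hpt : ∀ φ : PointConfig, (φ.count (unitSquare 0 0) : ℝ≥0∞) *
        (ENNReal.ofReal ((2 * (‖j‖ + 1)) ^ α) *
        ({φ : PointConfig | φ.count (D k j) = 0}.indicator 1 φ *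
        EReal.exp ((∑' i, (φ.count (unitSquare 0 i) : ℝ≥0∞) *
          ENNReal.ofReal (a * latticeDecay α (i - j)) : ℝ≥0∞) : EReal))) ≤
        ENNReal.ofReal ((2 * (‖j‖ + 1)) ^ α) *
        ({φ : PointConfig | φ.count (D k j) = 0}.indicator 1 φ *
        EReal.exp ((∑' i, (φ.count (unitSquare 0 i) : ℝ≥0∞) *
          ENNReal.ofReal (g j i) : ℝ≥0∞) : EReal)) := by
      intro φ
      have h1 : (φ.count (unitSquare 0 0) : ℝ≥0∞) ≤
          EReal.exp ((φ.count (unitSquare 0 0) : ℝ≥0∞) : EReal) := by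
        rw [EReal.exp_coe_ennreal (ENNReal.natCast_ne_top _), ENNReal.toReal_natCast,
          ← ENNReal.ofReal_natCast]
        refine ENNReal.ofReal_le_ofReal ?_
        linarith [Real.add_one_le_exp (φ.count (unitSquare 0 0) : ℝ)]
      have h2 : ∑' i, (φ.count (unitSquare 0 i) : ℝ≥0∞) * ENNReal.ofReal (g j i) =
          (φ.count (unitSquare 0 0) : ℝ≥0∞) + ∑' i, (φ.count (unitSquare 0 i) : ℝ≥0∞) *
          ENNReal.ofReal (a * latticeDecay α (i - j)) := by
        have h3 : (φ.count (unitSquare 0 0) : ℝ≥0∞) = ∑' i : Fin 2 → ℤ,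
            (φ.count (unitSquare 0 i) : ℝ≥0∞) * ENNReal.ofReal (if i = 0 then 1 else 0) := by
          rw [tsum_eq_single 0]
          · simp
          · intro i hi
            simp [hi]
        rw [h3, ← ENNReal.tsum_add]
        refine tsum_congr fun i => ?_
        rw [← mul_add, add_comm, ← ENNReal.ofReal_add (mul_nonneg ha0 (latticeDecay_nonneg _ _))
          (by split_ifs <;> norm_num)]
      rw [h2, EReal.coe_ennreal_add, EReal.exp_add, mul_left_comm, mul_left_comm
        (φ.count (unitSquare 0 0) : ℝ≥0∞)]
      gcongr
    refine (lintegral_mono hpt).trans ?_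
    rw [lintegral_const_mul' _ _ ENNReal.ofReal_ne_top, ENNReal.ofReal_mul (by positivity),
      mul_assoc]
    refine mul_le_mul' le_rfl ?_
    have hmain := hP.lintegral_void_mul_exp_tsum_count_le hlam.le hsq hsqb
      (pairwise_disjoint_unitSquare 0)
      (fun i => by rw [Measure.real, volume_unitSquare_zero, ENNReal.toReal_one])
      (hg0 j) (hgb j) (hgs j) (D := D k j) Metric.isOpen_ball.measurableSet Metric.isBounded_ball
    rw [hgt j] at hmain
    refine hmain.trans_eq ?_
    congr 4
    -- A ball of negative radius has volume `0`, which is where the maximum with `0` comes from.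
    rw [Measure.real, EuclideanSpace.volume_ball_fin_two, ENNReal.toReal_mul, ENNReal.toReal_pow,
      ENNReal.toReal_ofReal Real.pi_pos.le, ENNReal.toReal_ofReal']
    ring
  have hbound := hQ.lintegral_le (hsq 0) (hsqb 0)
    (F := fun φ => voidSum m α A (fun z : φ.points => (z : Plane) - x))
    (fun φ w hw => voidSum_translate_le (m := m) (by linarith) A φ x w hw.2)
  rw [volume_unitSquare_zero, mul_one] at hbound
  have hR : ∫⁻ φ, (φ.count (unitSquare 0 0) : ℝ≥0∞) * ∑' (k : Fin m) (j : Fin 2 → ℤ),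
      ENNReal.ofReal ((2 * (‖j‖ + 1)) ^ α) *
        ({φ : PointConfig | φ.count (D k j) = 0}.indicator 1 φ *
        EReal.exp ((∑' i, (φ.count (unitSquare 0 i) : ℝ≥0∞) *
          ENNReal.ofReal (a * latticeDecay α (i - j)) : ℝ≥0∞) : EReal)) ∂P < ∞ := by
    simp only [← ENNReal.tsum_mul_left]
    have hcm : ∀ i, Measurable fun φ : PointConfig => (φ.count (unitSquare 0 i) : ℝ≥0∞) :=
      fun i => (measurable_of_countable (fun n : ℕ => (n : ℝ≥0∞))).comp
        (PointConfig.measurable_count (hsq i) (hsqb i))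
    have hmeas : ∀ k j, Measurable fun φ : PointConfig => (φ.count (unitSquare 0 0) : ℝ≥0∞) *
      (ENNReal.ofReal ((2 * (‖j‖ + 1)) ^ α) *
        ({φ : PointConfig | φ.count (D k j) = 0}.indicator 1 φ *
        EReal.exp ((∑' i, (φ.count (unitSquare 0 i) : ℝ≥0∞) *
          ENNReal.ofReal (a * latticeDecay α (i - j)) : ℝ≥0∞) : EReal))) := by
      intro k j
      refine (hcm 0).mul (Measurable.const_mul (Measurable.mul (measurable_one.indicator ?_) ?_) _)
      · exact PointConfig.measurable_count Metric.isOpen_ball.measurableSet Metric.isBounded_ball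
          (measurableSet_singleton 0)
      · exact measurable_exp_coe_ennreal.comp (Measurable.tsum fun i => (hcm i).mul_const _)
    rw [lintegral_tsum fun k => (Measurable.tsum fun j => hmeas k j).aemeasurable, tsum_fintype,
      ENNReal.sum_lt_top]
    intro k _
    rw [lintegral_tsum fun j => (hmeas k j).aemeasurable]
    refine lt_of_le_of_lt (ENNReal.tsum_le_tsum fun j => hterm k j) ?_
    rw [ENNReal.tsum_mul_right]
    refine ENNReal.mul_lt_top ?_ ENNReal.ofReal_lt_top
    have hm0 : 0 < m := k.pos
    have hσ : 0 < Real.sin (Real.pi / m) := Real.sin_pos_of_pos_of_lt_pi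
      (div_pos Real.pi_pos (Nat.cast_pos.mpr hm0)) hm
    have hsum := summable_rpow_mul_exp_neg_sq (α := α) (κ := lam * Real.pi / 2) (by linarith)
      (by positivity) hσ
    exact hsum.tsum_ofReal_lt_top
  have hlt := hbound.trans_lt hR
  rw [ENNReal.mul_lt_top_iff] at hlt
  have hl0 : ENNReal.ofReal lam ≠ 0 := (ENNReal.ofReal_pos.mpr hlam).ne'
  rcases hlt with h1 | h1 | h1
  · exact h1.2
  · exact absurd h1 hl0
  · rw [h1]; exact ENNReal.zero_lt_top

/-! ### Conclusion -/

theorem theorem1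
    (α μ β γ N M : ℝ) (hα : 2 < α) (hμ : 0 < μ) (hβ : 0 < β) (hγ : 0 < γ) (hγ1 : γ < 1)
    (hN : 0 ≤ N) (hM : 0 < M) (m : ℕ) (hm0 : 0 < m)
    (hm : 2 * (Real.pi / m) < Real.pi / 2)
    (hβγ : β * γ < 1) :
    ∃ ε₀ : ℝ, 0 < ε₀ ∧ ε₀ ≤ 1 ∧ ∀ ε : ℝ, 0 < ε → ε < ε₀ →
      ∀ lam : ℝ, 0 < lam →
      ∀ P : Measure PointConfig, IsPoissonLaw lam P →
      ∀ (x : Plane) (Q : Measure PointConfig), IsPalmLaw lam P x Q →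
      ∀ {Ω : Type*} [MeasurableSpace Ω] (Pr : Measure Ω) [IsProbabilityMeasure Pr]
        (S : Network Ω m),
        IsNetwork S ⟨α, μ, β, γ, N, M, ε⟩ Pr Q x →
        AEMeasurable (S.exitTime ⟨α, μ, β, γ, N, M, ε⟩ 0) Pr ∧
          ∫⁻ ω, S.exitTime ⟨α, μ, β, γ, N, M, ε⟩ 0 ω ∂Pr < ∞ := by
  have hmm : Real.pi / m < Real.pi / 2 := by
    have : 0 < Real.pi / m := div_pos Real.pi_pos (Nat.cast_pos.mpr hm0)
    linarith
  -- The constant `2 / ((1 - ε) ε)` is finite for each `ε` strictly between `0` and `1`, so `ε₀ = 1`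
  -- serves every intensity.
  refine ⟨1, one_pos, le_rfl, ?_⟩
  intro ε he0 he lam hlam P hP x Q hQ Ω _ Pr _ S h
  set p : SINRParams := ⟨α, μ, β, γ, N, M, ε⟩
  have hα0 : 0 < α := by linarith
  refine ⟨(Network.measurable_exitTime p h.measurable_pos h.measurable_dest h.measurable_isOn
    h.measurable_fade).aemeasurable, ?_⟩
  set W : Ω → ℝ≥0∞ := fun ω => voidSum m α p.noiseFactor (fun i => S.pos i ω - x)
  set F : PointConfig → ℝ≥0∞ :=
    fun φ => voidSum m α p.noiseFactor (fun z : φ.points => (z : Plane) - x)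
  -- The labels enumerate the nodes without repetition, so the sum over labels is a function of the
  -- configuration and its mean can be taken under `Q`.
  have hWF : ∀ᵐ ω ∂Pr, W ω = F (S.config ω) := by
    filter_upwards [h.pos_enum] with ω hω
    exact voidSum_comp_equiv m α p.noiseFactor
      ((Equiv.ofInjective _ hω.1).trans (Equiv.setCongr hω.2)) fun z => (z : Plane) - x
  have hFm : Measurable F := PointConfig.measurable_voidSum m α _ x
  have hWint : ∫⁻ ω, W ω ∂Pr < ∞ := by
    rw [lintegral_congr_ae hWF, h.config_law.lintegral_comp hFm.aemeasurable]
    exact hQ.lintegral_voidSum_lt_top hlam hP (by linarith [Real.pi_pos]) hα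
      (SINRParams.noiseFactor_ne_top (p := p) hμ)
  -- `W` involves the positions only, hence it is known at the start of every slot, as the exit time
  -- bound requires.
  have hWm : ∀ t, Measurable[S.history t] W := fun t =>
    @measurable_voidSum Ω (S.history t) m α _ _ fun i =>
      (measurable_id.sub_const x).comp (S.measurable_pos_history t i)
  have hWm' : Measurable W := (hWm 0).mono (h.history_le 0) le_rfl
  have hWt : ∀ᵐ ω ∂Pr, W ω ≠ ∞ := (ae_lt_top hWm' hWint.ne).mono fun _ hω => hω.ne
  set C := ENNReal.ofReal (2 / ((1 - ε) * ε) * Real.exp (μ * (β * N / p.c + 1)))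
  have hC0 : C ≠ 0 := by
    have : 0 < 1 - ε := by linarith
    exact (ENNReal.ofReal_pos.mpr (by positivity)).ne'
  refine lt_of_le_of_lt (h.lintegral_exitTime_le hμ hM he0 he hβ hN (V := fun ω => C * W ω)
    (fun t => ?_) ?_ ?_ fun t => ?_) ?_
  · exact (measurable_const_mul C).comp (hWm t)
  · exact ae_of_all _ fun ω =>
      mul_ne_zero hC0 (one_pos.trans_le (one_le_voidSum hm0 hα0.le _ _)).ne'
  · exact hWt.mono fun ω hω => ENNReal.mul_ne_top ENNReal.ofReal_ne_top hω
  · filter_upwards [h.pos_enum, h.pos_zero, hWt] with ω h1 h2 h3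
    obtain ⟨h4, h5⟩ := S.regular_and_invSuccessBound_le (p := p) (t := t) hmm hα0 hμ hM he h2 h1.1
      h1.2 h3
    exact ⟨h4, mul_le_mul' le_rfl h5⟩
  · rw [lintegral_const_mul _ hWm']
    exact ENNReal.mul_lt_top ENNReal.ofReal_lt_top hWint
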